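/- Let $n$ be a natural number, $\chi:\{1,\dots,n\}\to\{\ell,r\}$ and $\epsilon\in\{',''\}^n$. For partitions of $\{1,\dots,n\}$, write $\pi\le\sigma$ if every block of $\pi$ is contained in a block of $\sigma$, and let $|\pi|$ be the number of blocks of $\pi$. * Let $i_1<\dots<i_p$ be the elements of $\chi^{-1}(\ell)$ and $j_1<\dots<j_{n-p}$ those of $\chi^{-1}(r)$, and let $s_\chi\in S_n$ be given by $s_\chi(k)=i_k$ for $k\le p$ and $s_\chi(k)=j_{n+1-k}$ for $k>p$. $BNC(\chi)$ is the set, ordered by $\le$, of partitions $\pi$ such that $s_\chi^{-1}\cdot\pi$ is non-crossing, and $\mu_{BNC}$ is the Möbius function of this poset, i.e. the two-sided convolution inverse of the zeta function in its incidence algebra over $\mathbb{C}$. * $LR(\chi,\epsilon)$ is the set of diagrams obtained as follows from the empty diagram by placing the nodes $n,n-1,\dots,1$ successively, from bottom to top. Node $k$ has shade $\epsilon_k$ and is placed above the present diagram, on the left if $\chi(k)=\ell$ and on the right if $\chi(k)=r$; the spines reaching the gap at the top of the present diagram are extended upwards to the new top gap. If there is at least one such spine and the one nearest to node $k$ (the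 leftmost, resp. rightmost, one) has shade $\epsilon_k$, then node $k$ is connected to it, and this spine either ends at node $k$ or continues to the top gap. Otherwise node $k$ either is left isolated or is connected to a new spine of shade $\epsilon_k$, nearest to its side, that reaches the top gap. $BNC(\chi,\epsilon)$ is the set of partitions of $\{1,\dots,n\}$ into connected components of nodes given by those diagrams in $LR(\chi,\epsilon)$ in which no spine reaches the top gap. * Two blocks $V,W$ are piled if $\max(\min V,\min W)\le\min(\max V,\max W)$. Write $\sigma\ge_{\mathrm{lat}}\pi$ if $\pi\le\sigma$ and no two distinct piled blocks of $\pi$ are contained in the same block of $\sigma$. * Write $\pi\le\epsilon$ if $\epsilon$ is constant on every block of $\pi$, i.e. if $\pi$ refines the partition of $\{1,\dots,n\}$ induced by $\epsilon$. Then for every $\pi\in BNC(\chi)$ with $\pi\le\epsilon$, $$\sum_{\substack{\sigma\in BNC(\chi,\epsilon)\\ \sigma\ge_{\mathrm{lat}}\pi}}(-1)^{|\pi|-|\sigma|}=\sum_{\substack{\sigma\in BNC(\chi)\\ \pi\le\sigma\le\epsilon}}\mu_{BNC}(\pi,\sigma).$$ -/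

import Mathlib

open Finset

/-- The two sides on which a node of a bi-non-crossing diagram may lie. -/
inductive Side
  | left
  | right
  deriving DecidableEq

/-- The two shades `'` and `''`. -/
inductive Shade
  | prime
  | dblprime
  deriving DecidableEq

/-- Partitions of the node set. The nodes are `0, …, n - 1` rather than `1, …, n`. Mathlib's order
on `Finpartition` is refinement: `π ≤ σ` iff every block of `π` is contained in a block of `σ`. -/
abbrev NodePartition (n : ℕ) := Finpartition (univ : Finset (Fin n))

/-! ### Bi-non-crossing partitions -/

/-- A partition is non-crossing if there are no two distinct blocks `V`, `W` and no
`a < b < c < d` with `a, c ∈ V` and `b, d ∈ W`. -/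
def NonCrossing {n : ℕ} (π : NodePartition n) : Prop :=
  ∀ V ∈ π.parts, ∀ W ∈ π.parts, V ≠ W →
    ∀ a ∈ V, ∀ c ∈ V, ∀ b ∈ W, ∀ d ∈ W, ¬ (a < b ∧ b < c ∧ c < d)

/-- The definition by gaps: for distinct blocks `V`, `W`, a gap `(v, v')` between consecutive
elements of `V` contains the least element of `W` iff it contains the greatest one. -/
theorem nonCrossing_iff_gaps {n : ℕ} (π : NodePartition n) :
    NonCrossing π ↔
      ∀ V ∈ π.parts, ∀ W ∈ π.parts, V ≠ W →
        ∀ v ∈ V, ∀ v' ∈ V, v < v' → (∀ u ∈ V, ¬ (v < u ∧ u < v')) →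
          ∀ w₁ w₂, IsLeast (W : Set (Fin n)) w₁ → IsGreatest (W : Set (Fin n)) w₂ →
            (v < w₁ ∧ w₁ < v' ↔ v < w₂ ∧ w₂ < v') := by
  have hdis : ∀ V ∈ π.parts, ∀ W ∈ π.parts, V ≠ W → ∀ x ∈ V, ∀ y ∈ W, x ≠ y := by
    intro V hV W hW hne x hx y hy hxy
    exact Finset.disjoint_left.mp (π.disjoint hV hW hne) hx (hxy ▸ hy)
  constructor
  · intro h V hV W hW hne v hv v' hv' hvv' _ w₁ w₂ hw₁ hw₂
    have h1 : w₁ ∈ W := hw₁.1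
    have h2 : w₂ ∈ W := hw₂.1
    have h12 : w₁ ≤ w₂ := hw₁.2 hw₂.1
    constructor
    · rintro ⟨ha, hb⟩
      refine ⟨lt_of_lt_of_le ha h12, ?_⟩
      by_contra hc
      exact h V hV W hW hne v hv v' hv' w₁ h1 w₂ h2
        ⟨ha, hb, lt_of_le_of_ne (not_lt.mp hc) (hdis V hV W hW hne v' hv' w₂ h2)⟩
    · rintro ⟨ha, hb⟩
      refine ⟨?_, lt_of_le_of_lt h12 hb⟩
      by_contra hc
      exact h W hW V hV hne.symm w₁ h1 w₂ h2 v hv v' hv'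
        ⟨lt_of_le_of_ne (not_lt.mp hc) (hdis V hV W hW hne v hv w₁ h1).symm, ha, hb⟩
  · intro h
    -- If `min V < min W`, the gap of `V` around `min W` contains all of `W`.
    have key : ∀ V ∈ π.parts, ∀ W ∈ π.parts, V ≠ W → ∀ (hV : V.Nonempty) (hW : W.Nonempty),
        V.min' hV < W.min' hW → ∀ x ∈ V, ∀ y ∈ W, ∀ z ∈ W, ¬ (y < x ∧ x < z) := by
      intro V hVp W hWp hne hV hW hlt x hx y hy z hz ⟨hyx, hxz⟩
      set m := W.min' hW with hm
      have hmW : m ∈ W := W.min'_mem hW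
      have hbelow : (V.filter (· < m)).Nonempty :=
        ⟨V.min' hV, mem_filter.mpr ⟨V.min'_mem hV, hlt⟩⟩
      have habove : (V.filter (m < ·)).Nonempty :=
        ⟨x, mem_filter.mpr ⟨hx, lt_of_le_of_lt (W.min'_le y hy) hyx⟩⟩
      obtain ⟨hv, hvm⟩ := mem_filter.mp (max'_mem _ hbelow)
      obtain ⟨hv', hmv'⟩ := mem_filter.mp (min'_mem _ habove)
      have hcons : ∀ u ∈ V, ¬ ((V.filter (· < m)).max' hbelow < u ∧
          u < (V.filter (m < ·)).min' habove) := by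
        rintro u hu ⟨h1, h2⟩
        rcases lt_trichotomy u m with h3 | h3 | h3
        · exact absurd (le_max' _ u (mem_filter.mpr ⟨hu, h3⟩)) (not_le.mpr h1)
        · exact hdis V hVp W hWp hne u hu m hmW h3
        · exact absurd (min'_le _ u (mem_filter.mpr ⟨hu, h3⟩)) (not_le.mpr h2)
      have := (h V hVp W hWp hne _ hv _ hv' (hvm.trans hmv') hcons m (W.max' hW)
        (W.isLeast_min' hW) (W.isGreatest_max' hW)).mp ⟨hvm, hmv'⟩
      exact hcons x hx ⟨(hvm.trans_le (W.min'_le y hy)).trans hyx,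
        hxz.trans ((W.le_max' z hz).trans_lt this.2)⟩
    intro V hV W hW hne a ha c hc b hb d hd ⟨hab, hbc, hcd⟩
    rcases lt_trichotomy (V.min' ⟨a, ha⟩) (W.min' ⟨b, hb⟩) with h1 | h1 | h1
    · exact key V hV W hW hne _ _ h1 c hc b hb d hd ⟨hbc, hcd⟩
    · exact hdis V hV W hW hne _ (min'_mem _ _) _ (min'_mem _ _) h1
    · exact key W hW V hV hne.symm _ _ h1 b hb a ha c hc ⟨hab, hbc⟩

/-- The action of permutations on partitions: `s · {V₁, …, Vₖ} = {s(V₁), …, s(Vₖ)}`. -/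
def permute {n : ℕ} (s : Equiv.Perm (Fin n)) (π : NodePartition n) : NodePartition n :=
  Finpartition.ofExistsUnique (π.parts.image (fun V => V.map s.toEmbedding))
    (fun _ _ => subset_univ _)
    (by
      intro a _
      obtain ⟨V, ⟨hV, haV⟩, huniq⟩ := π.existsUnique_mem (mem_univ (s.symm a))
      refine ⟨V.map s.toEmbedding, ⟨mem_image_of_mem _ hV, ?_⟩, ?_⟩
      · exact mem_map.mpr ⟨s.symm a, haV, by simp⟩
      · rintro U ⟨hU, haU⟩
        obtain ⟨V', hV', rfl⟩ := mem_image.mp hU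
        obtain ⟨x, hx, hxa⟩ := mem_map.mp haU
        have hxs : x = s.symm a := by simp [← hxa]
        rw [huniq V' ⟨hV', hxs ▸ hx⟩])
    (by
      intro h
      obtain ⟨V, hV, hVe⟩ := mem_image.mp h
      exact π.ne_bot hV (map_eq_empty.mp hVe))

/-- The left nodes `χ⁻¹(ℓ)`. -/
def leftNodes {n : ℕ} (χ : Fin n → Side) : Finset (Fin n) :=
  univ.filter (fun k => χ k = Side.left)

theorem card_left_add_card_right {n : ℕ} (χ : Fin n → Side) :
    n = #(leftNodes χ) + #(leftNodes χ)ᶜ := by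
  simp [Finset.card_add_card_compl]

/-- The permutation `s_χ` which lists the left nodes in increasing order and then the right nodes
in decreasing order. -/
def sPerm {n : ℕ} (χ : Fin n → Side) : Equiv.Perm (Fin n) :=
  (finCongr (card_left_add_card_right χ)).trans <|
    finSumFinEquiv.symm.trans <|
      (Equiv.sumCongr (Equiv.refl _) Fin.revPerm).trans <|
        finSumEquivOfFinset (s := leftNodes χ) rfl rfl

theorem sPerm_left {n : ℕ} (χ : Fin n → Side) (i : Fin #(leftNodes χ)) :
    sPerm χ (Fin.cast (card_left_add_card_right χ).symm (Fin.castAdd _ i)) =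
      (leftNodes χ).orderEmbOfFin rfl i := by
  simp [sPerm]

theorem sPerm_right {n : ℕ} (χ : Fin n → Side) (i : Fin #(leftNodes χ)ᶜ) :
    sPerm χ (Fin.cast (card_left_add_card_right χ).symm (Fin.natAdd _ i)) =
      (leftNodes χ)ᶜ.orderEmbOfFin rfl i.rev := by
  simp [sPerm]

/-- `π` is bi-non-crossing with respect to `χ` if `s_χ⁻¹ · π` is non-crossing. -/
def IsBiNonCrossing {n : ℕ} (χ : Fin n → Side) (π : NodePartition n) : Prop :=
  NonCrossing (permute (sPerm χ)⁻¹ π)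

/-- `BNC(χ)`, ordered by refinement. -/
abbrev BNC {n : ℕ} (χ : Fin n → Side) := {π : NodePartition n // IsBiNonCrossing χ π}

noncomputable instance {n : ℕ} (χ : Fin n → Side) : Fintype (BNC χ) :=
  Fintype.ofFinite _

open Classical in
noncomputable instance {n : ℕ} (χ : Fin n → Side) : LocallyFiniteOrder (BNC χ) :=
  Fintype.toLocallyFiniteOrder

open Classical in
/-- The Möbius function `μ_BNC` on `BNC(χ)`, the two-sided convolution inverse of the zeta function
in the complex incidence algebra. -/
noncomputable def muBNC {n : ℕ} {χ : Fin n → Side} (π σ : BNC χ) : ℂ :=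
  IncidenceAlgebra.mu ℂ π σ

/-! ### Shaded diagrams -/

/-- The combinatorial data of a shaded diagram on the nodes `0, …, n - 1` (numbered from top to
bottom): the blocks whose spines do not reach the top gap, and the blocks, with their shades, whose
spines do reach the top gap, listed from left to right. -/
structure LRDiagram (n : ℕ) where
  closed : Finset (Finset (Fin n))
  spines : List (Finset (Fin n) × Shade)
  deriving DecidableEq

/-- Renumber the nodes of a diagram by `k ↦ k + 1`, making room for a new top node `0`. -/
def LRDiagram.shift {n : ℕ} (D : LRDiagram n) : LRDiagram (n + 1) where
  closed := D.closed.image (fun B => B.map (Fin.succEmb n))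
  spines := D.spines.map (fun S => (S.1.map (Fin.succEmb n), S.2))

/-- Reads a left-to-right list of spines starting from the given side; it is its own inverse. -/
def fromSide {α : Type*} : Side → List α → List α
  | Side.left, l => l
  | Side.right, l => l.reverse

/-- The diagrams obtained from `D` by placing a new top node `0` of shade `c` on the side `s`.
If there is a spine reaching the top gap and the one nearest to the new node has shade `c`, then
the node is connected to it, and the spine either continues to the top gap or ends at the node.
Otherwise the node either is isolated or starts a new spine reaching the top gap. -/
def LRDiagram.extensions {n : ℕ} (s : Side) (c : Shade) (D : LRDiagram n) :
    Finset (LRDiagram (n + 1)) :=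
  let closed := D.shift.closed
  let spines := D.shift.spines
  let addNew : Finset (LRDiagram (n + 1)) :=
    {⟨insert {0} closed, spines⟩, ⟨closed, fromSide s (({0}, c) :: fromSide s spines)⟩}
  match fromSide s spines with
  | [] => addNew
  | (B, c') :: rest =>
    if c' = c then
      {⟨closed, fromSide s ((insert 0 B, c) :: rest)⟩,
        ⟨insert (insert 0 B) closed, fromSide s rest⟩}
    else addNew

/-- The collection `LR(χ, ε)` of shaded diagrams, built from the bottom node upwards. -/
def LR : {n : ℕ} → (Fin n → Side) → (Fin n → Shade) → Finset (LRDiagram n)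
  | 0, _, _ => {⟨∅, []⟩}
  | _ + 1, χ, ε => (LR (Fin.tail χ) (Fin.tail ε)).biUnion (LRDiagram.extensions (χ 0) (ε 0))

/-- `LR_k(χ, ε)`: the diagrams with exactly `k` chords extending to the top gap. -/
def LRk {n : ℕ} (k : ℕ) (χ : Fin n → Side) (ε : Fin n → Shade) : Finset (LRDiagram n) :=
  (LR χ ε).filter (fun D => D.spines.length = k)

/-- `BNC(χ, ε)`: the partitions whose blocks are the connected components of the nodes in some
diagram in `LR₀(χ, ε)`. -/
def shadedBNC {n : ℕ} (χ : Fin n → Side) (ε : Fin n → Shade) : Set (NodePartition n) :=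
  {σ | ∃ D ∈ LRk 0 χ ε, σ.parts = D.closed}

/-- The partition into (at most two) blocks induced by a shading. -/
def shadingPartition {n : ℕ} (ε : Fin n → Shade) : NodePartition n :=
  haveI : DecidableRel (Setoid.ker ε).r := fun a b => inferInstanceAs (Decidable (ε a = ε b))
  Finpartition.ofSetoid (Setoid.ker ε)

/-! ### Lateral refinement -/

/-- Nonempty `V`, `W` are piled if `max (min V) (min W) ≤ min (max V) (max W)`. -/
def Piled {n : ℕ} (V W : Finset (Fin n)) : Prop :=
  ∃ (hV : V.Nonempty) (hW : W.Nonempty),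
    max (V.min' hV) (W.min' hW) ≤ min (V.max' hV) (W.max' hW)

/-- `π ≤_lat σ`: `π` refines `σ`, and no two (distinct) piled blocks of `π` are contained in the
same block of `σ`. -/
def LateralRefinement {n : ℕ} (π σ : NodePartition n) : Prop :=
  π ≤ σ ∧ ∀ V ∈ π.parts, ∀ W ∈ π.parts, V ≠ W → Piled V W →
    ¬ ∃ U ∈ σ.parts, V ⊆ U ∧ W ⊆ U

/-- The order in which `s_χ` lists the nodes: it is decided by the side of the upper node. -/
def SideLT {n : ℕ} (χ : Fin n → Side) (a b : Fin n) : Prop :=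
  (a < b ∧ χ a = Side.left) ∨ (b < a ∧ χ b = Side.right)

theorem SideLT.asymm {n : ℕ} {χ : Fin n → Side} {a b : Fin n} (h : SideLT χ a b) :
    ¬ SideLT χ b a := by
  rintro (h' | h') <;> rcases h with h | h
  · exact lt_asymm h.1 h'.1
  · rw [h.2] at h'; cases h'.2
  · rw [h.2] at h'; cases h'.2
  · exact lt_asymm h.1 h'.1

theorem SideLT.irrefl {n : ℕ} {χ : Fin n → Side} {a : Fin n} : ¬ SideLT χ a a :=
  fun h => h.asymm h

theorem sideLT_sPerm_of_lt {n : ℕ} (χ : Fin n → Side) {p q : Fin n} (h : p < q) :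
    SideLT χ (sPerm χ p) (sPerm χ q) := by
  have hl : ∀ i, χ ((leftNodes χ).orderEmbOfFin rfl i) = Side.left := fun i => by
    have := (leftNodes χ).orderEmbOfFin_mem rfl i
    simpa [leftNodes] using this
  have hr : ∀ i, χ ((leftNodes χ)ᶜ.orderEmbOfFin rfl i) = Side.right := fun i => by
    have := (leftNodes χ)ᶜ.orderEmbOfFin_mem rfl i
    cases h : χ ((leftNodes χ)ᶜ.orderEmbOfFin rfl i) with
    | left => exact absurd h (by simpa [leftNodes] using this)
    | right => rfl
  obtain ⟨p, rfl⟩ := (finCongr (card_left_add_card_right χ).symm).surjective p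
  obtain ⟨q, rfl⟩ := (finCongr (card_left_add_card_right χ).symm).surjective q
  have h' : p < q := h
  induction p using Fin.addCases with
  | left i =>
    induction q using Fin.addCases with
    | left j =>
      have hij : i < j := h'
      simp only [finCongr_apply, sPerm_left]
      exact Or.inl ⟨by simpa using hij, hl _⟩
    | right j =>
      simp only [finCongr_apply, sPerm_left, sPerm_right]
      rcases lt_trichotomy ((leftNodes χ).orderEmbOfFin rfl i)
        ((leftNodes χ)ᶜ.orderEmbOfFin rfl j.rev) with h | h | h
      · exact Or.inl ⟨h, hl _⟩
      · have := hl i; rw [h, hr] at this; cases this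
      · exact Or.inr ⟨h, hr _⟩
  | right i =>
    induction q using Fin.addCases with
    | left j =>
      exfalso
      simp only [Fin.lt_def, Fin.val_natAdd, Fin.val_castAdd] at h'
      omega
    | right j =>
      have hij : i < j := Nat.lt_of_add_lt_add_left h'
      simp only [finCongr_apply, sPerm_right]
      exact Or.inr ⟨by simpa using hij, hr _⟩

theorem sideLT_sPerm {n : ℕ} (χ : Fin n → Side) (p q : Fin n) :
    SideLT χ (sPerm χ p) (sPerm χ q) ↔ p < q := by
  refine ⟨fun h => ?_, sideLT_sPerm_of_lt χ⟩
  rcases lt_trichotomy p q with h' | rfl | h'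
  · exact h'
  · exact absurd h SideLT.irrefl
  · exact absurd (sideLT_sPerm_of_lt χ h') h.asymm

theorem mem_parts_permute {n : ℕ} (s : Equiv.Perm (Fin n)) (π : NodePartition n)
    (V : Finset (Fin n)) :
    V ∈ (permute s π).parts ↔ ∃ U ∈ π.parts, U.map s.toEmbedding = V := by
  simp [permute, Finpartition.ofExistsUnique]

theorem isBiNonCrossing_iff {n : ℕ} (χ : Fin n → Side) (π : NodePartition n) :
    IsBiNonCrossing χ π ↔ ∀ V ∈ π.parts, ∀ W ∈ π.parts, V ≠ W →
      ∀ a ∈ V, ∀ c ∈ V, ∀ b ∈ W, ∀ d ∈ W, ¬ (SideLT χ a b ∧ SideLT χ b c ∧ SideLT χ c d) := by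
  have hs : ∀ x, (sPerm χ) ((sPerm χ)⁻¹ x) = x := fun x => by simp
  have key : ∀ x y, (sPerm χ)⁻¹ x < (sPerm χ)⁻¹ y ↔ SideLT χ x y := fun x y => by
    rw [← sideLT_sPerm, hs, hs]
  constructor
  · intro h V hV W hW hne a ha c hc b hb d hd hx
    refine h _ ((mem_parts_permute _ _ _).2 ⟨V, hV, rfl⟩) _
      ((mem_parts_permute _ _ _).2 ⟨W, hW, rfl⟩) (fun e => hne (Finset.map_injective _ e))
      _ (mem_map_of_mem _ ha) _ (mem_map_of_mem _ hc) _ (mem_map_of_mem _ hb)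
      _ (mem_map_of_mem _ hd) ?_
    simpa only [Equiv.toEmbedding_apply, key] using hx
  · intro h V' hV W' hW hne a' ha c' hc b' hb d' hd hx
    obtain ⟨V, hV', rfl⟩ := (mem_parts_permute _ _ _).1 hV
    obtain ⟨W, hW', rfl⟩ := (mem_parts_permute _ _ _).1 hW
    obtain ⟨a, ha', rfl⟩ := mem_map.1 ha
    obtain ⟨b, hb', rfl⟩ := mem_map.1 hb
    obtain ⟨c, hc', rfl⟩ := mem_map.1 hc
    obtain ⟨d, hd', rfl⟩ := mem_map.1 hd
    refine h V hV' W hW' (fun e => hne (by rw [e])) a ha' c hc' b hb' d hd' ?_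
    simpa only [Equiv.toEmbedding_apply, key] using hx

/-- The partition is bi-non-crossing, in terms of its membership function. -/
theorem IsBiNonCrossing.part_eq {n : ℕ} {χ : Fin n → Side} {π : NodePartition n}
    (h : IsBiNonCrossing χ π) {a b c d : Fin n} (hab : SideLT χ a b) (hbc : SideLT χ b c)
    (hcd : SideLT χ c d) (hac : π.part a = π.part c) (hbd : π.part b = π.part d) :
    π.part a = π.part b := by
  by_contra hne
  exact (isBiNonCrossing_iff χ π).1 h _ (π.part_mem.2 (mem_univ a)) _
    (π.part_mem.2 (mem_univ b)) hne a (π.mem_part (mem_univ a)) c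
    (hac ▸ π.mem_part (mem_univ c)) b (π.mem_part (mem_univ b)) d
    (hbd ▸ π.mem_part (mem_univ d)) ⟨hab, hbc, hcd⟩

@[simp]
theorem mem_fromSide {α : Type*} (s : Side) (l : List α) (x : α) : x ∈ fromSide s l ↔ x ∈ l := by
  cases s <;> simp [fromSide]

theorem fromSide_fromSide {α : Type*} (s : Side) (l : List α) :
    fromSide s (fromSide s l) = l := by
  cases s <;> simp [fromSide]

theorem fromSide_map {α β : Type*} (s : Side) (g : α → β) (l : List α) :
    fromSide s (l.map g) = (fromSide s l).map g := by
  cases s <;> simp [fromSide]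

/-- The nodes of a block after renumbering by `k ↦ k + 1`. -/
abbrev shiftBlock {n : ℕ} (B : Finset (Fin n)) : Finset (Fin (n + 1)) := B.map (Fin.succEmb n)

@[simp]
theorem zero_notMem_shiftBlock {n : ℕ} (B : Finset (Fin n)) : (0 : Fin (n + 1)) ∉ shiftBlock B := by
  simp [shiftBlock]

@[simp]
theorem succ_mem_shiftBlock {n : ℕ} (B : Finset (Fin n)) (i : Fin n) :
    i.succ ∈ shiftBlock B ↔ i ∈ B := by
  simp [shiftBlock]

theorem exists_succ_eq {n : ℕ} {B : Finset (Fin n)} {x : Fin (n + 1)} (hx : x ∈ shiftBlock B) :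
    ∃ i : Fin n, i.succ = x := by
  obtain ⟨i, -, rfl⟩ := mem_map.1 hx
  exact ⟨i, rfl⟩

/-- Read from the side `s`, the spines of `D` are a nearest spine `B` of shade `c` to which a new
node of shade `c` has to be connected, followed by the spines `R`; or there is no such spine,
in which case `B` is empty and `R` lists all spines. -/
def Attaches {n : ℕ} (s : Side) (c : Shade) (D : LRDiagram n) (B : Finset (Fin n))
    (R : List (Finset (Fin n) × Shade)) : Prop :=
  fromSide s D.spines = (B, c) :: R ∨
    (B = ∅ ∧ fromSide s D.spines = R ∧ ∀ S ∈ R.head?, S.2 ≠ c)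

/-- The extension of `D` in which the spine of the new node ends there. -/
def LRDiagram.ending {n : ℕ} (s : Side) (D : LRDiagram n) (B : Finset (Fin n))
    (R : List (Finset (Fin n) × Shade)) : LRDiagram (n + 1) :=
  ⟨insert (insert 0 (shiftBlock B)) D.shift.closed,
    fromSide s (R.map fun S => (shiftBlock S.1, S.2))⟩

/-- The extension of `D` in which the spine of the new node reaches the top gap. -/
def LRDiagram.continuing {n : ℕ} (s : Side) (c : Shade) (D : LRDiagram n) (B : Finset (Fin n))
    (R : List (Finset (Fin n) × Shade)) : LRDiagram (n + 1) :=
  ⟨D.shift.closed,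
    fromSide s ((insert 0 (shiftBlock B), c) :: R.map fun S => (shiftBlock S.1, S.2))⟩

theorem exists_attaches {n : ℕ} (s : Side) (c : Shade) (D : LRDiagram n) :
    ∃ B R, Attaches s c D B R ∧ ∀ E, E ∈ LRDiagram.extensions s c D ↔
      E = D.ending s B R ∨ E = D.continuing s c B R := by
  have hsp : fromSide s D.shift.spines =
      (fromSide s D.spines).map fun S => (shiftBlock S.1, S.2) := fromSide_map _ _ _
  have hsp' : D.shift.spines =
      fromSide s ((fromSide s D.spines).map fun S => (shiftBlock S.1, S.2)) := by
    rw [← hsp, fromSide_fromSide]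
  unfold Attaches LRDiagram.extensions LRDiagram.ending LRDiagram.continuing
  rcases hL : fromSide s D.spines with _ | ⟨⟨B, c'⟩, R⟩
  · refine ⟨∅, [], Or.inr (by simp), fun E => ?_⟩
    rw [hL] at hsp hsp'
    simp only [hsp, List.map_nil]
    rw [hsp']
    simp [shiftBlock]
  · rw [hL] at hsp hsp'
    by_cases hc : c' = c
    · subst hc
      refine ⟨B, R, Or.inl rfl, fun E => ?_⟩
      simp [hsp, or_comm]
    · refine ⟨∅, (B, c') :: R, Or.inr (by simpa using hc), fun E => ?_⟩
      simp only [hsp, List.map_cons, if_neg hc]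
      rw [hsp']
      simp [shiftBlock]

/-- `SideLT`, read from the side `s`. -/
def SideLTFrom {n : ℕ} (χ : Fin n → Side) : Side → Fin n → Fin n → Prop
  | Side.left, a, b => SideLT χ a b
  | Side.right, a, b => SideLT χ b a

theorem SideLTFrom.asymm {n : ℕ} {χ : Fin n → Side} {s : Side} {a b : Fin n}
    (h : SideLTFrom χ s a b) : ¬ SideLTFrom χ s b a := by
  cases s <;> exact SideLT.asymm h

theorem sideLTFrom_zero {n : ℕ} (χ : Fin (n + 1) → Side) (i : Fin n) :
    SideLTFrom χ (χ 0) 0 i.succ := by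
  cases h : χ 0
  · exact Or.inl ⟨Fin.succ_pos i, h⟩
  · exact Or.inr ⟨Fin.succ_pos i, h⟩

theorem sideLT_tail {n : ℕ} {χ : Fin (n + 1) → Side} {a b : Fin n} :
    SideLT (Fin.tail χ) a b ↔ SideLT χ a.succ b.succ := by
  simp [SideLT, Fin.tail]

theorem sideLTFrom_tail {n : ℕ} {χ : Fin (n + 1) → Side} {s : Side} {a b : Fin n} :
    SideLTFrom (Fin.tail χ) s a b ↔ SideLTFrom χ s a.succ b.succ := by
  cases s <;> exact sideLT_tail

/-- A top node is not strictly between two nodes. -/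
theorem ne_zero_of_between {n : ℕ} {χ : Fin (n + 1) → Side} {x y z : Fin (n + 1)}
    (hxy : SideLT χ x y) (hyz : SideLT χ y z) : y ≠ 0 := by
  rintro rfl
  rcases hxy with h | h
  · exact absurd h.1 (Fin.not_lt_zero x)
  · rcases hyz with h' | h'
    · rw [h.2] at h'; cases h'.2
    · exact absurd h'.1 (Fin.not_lt_zero z)

theorem pairwise_fromSide {n : ℕ} (χ : Fin n → Side) (s : Side)
    (l : List (Finset (Fin n) × Shade)) :
    (fromSide s l).Pairwise (fun S T => ∀ x ∈ S.1, ∀ y ∈ T.1, SideLTFrom χ s x y) ↔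
      l.Pairwise (fun S T => ∀ x ∈ S.1, ∀ y ∈ T.1, SideLT χ x y) := by
  cases s
  · rfl
  · simp only [fromSide, List.pairwise_reverse, SideLTFrom]
    refine List.Pairwise.iff ?_
    intro S T
    exact ⟨fun h x hx y hy => h y hy x hx, fun h x hx y hy => h y hy x hx⟩

/-- The properties shared by all diagrams in `LR χ ε`. -/
structure LRDiagram.Planar {n : ℕ} (χ : Fin n → Side) (ε : Fin n → Shade) (D : LRDiagram n) :
    Prop where
  cover : ∀ i, (∃ X ∈ D.closed, i ∈ X) ∨ ∃ S ∈ D.spines, i ∈ S.1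
  nonempty_closed : ∀ X ∈ D.closed, X.Nonempty
  nonempty_spine : ∀ S ∈ D.spines, S.1.Nonempty
  shade_closed : ∀ X ∈ D.closed, ∀ i ∈ X, ∀ j ∈ X, ε i = ε j
  shade_spine : ∀ S ∈ D.spines, ∀ i ∈ S.1, ε i = S.2
  disjoint_closed : ∀ X ∈ D.closed, ∀ Y ∈ D.closed, ∀ i ∈ X, i ∈ Y → X = Y
  disjoint_spine : ∀ X ∈ D.closed, ∀ S ∈ D.spines, ∀ i ∈ X, i ∉ S.1
  sorted : D.spines.Pairwise (fun S T => ∀ x ∈ S.1, ∀ y ∈ T.1, SideLT χ x y)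
  hull : ∀ X ∈ D.closed, ∀ S ∈ D.spines, ∀ x ∈ X, ∀ y ∈ S.1, ∀ z ∈ X,
    ¬ (SideLT χ x y ∧ SideLT χ y z)
  nonCrossing : ∀ X ∈ D.closed, ∀ Y ∈ D.closed, X ≠ Y → ∀ a ∈ X, ∀ c ∈ X, ∀ b ∈ Y, ∀ d ∈ Y,
    ¬ (SideLT χ a b ∧ SideLT χ b c ∧ SideLT χ c d)

section Attach

variable {n : ℕ} {s : Side} {c : Shade} {D : LRDiagram n} {B : Finset (Fin n)}
  {R : List (Finset (Fin n) × Shade)}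

theorem Attaches.mem_rest (h : Attaches s c D B R) {S} (hS : S ∈ R) : S ∈ D.spines := by
  rw [← mem_fromSide s]
  rcases h with h | ⟨-, h, -⟩ <;> rw [h]
  · exact List.mem_cons_of_mem _ hS
  · exact hS

theorem Attaches.mem_nearest (h : Attaches s c D B R) {i} (hi : i ∈ B) : (B, c) ∈ D.spines := by
  rw [← mem_fromSide s]
  rcases h with h | ⟨rfl, h, -⟩
  · rw [h]; exact List.mem_cons_self
  · simp at hi

theorem Attaches.mem_spines (h : Attaches s c D B R) {S} (hS : S ∈ D.spines) :
    S = (B, c) ∨ S ∈ R := by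
  rw [← mem_fromSide s] at hS
  rcases h with h | ⟨-, h, -⟩ <;> rw [h] at hS
  · exact List.mem_cons.1 hS
  · exact Or.inr hS

theorem Attaches.sorted {χ : Fin n → Side} (h : Attaches s c D B R)
    (hD : D.spines.Pairwise (fun S T => ∀ x ∈ S.1, ∀ y ∈ T.1, SideLT χ x y)) :
    (∀ x ∈ B, ∀ S ∈ R, ∀ y ∈ S.1, SideLTFrom χ s x y) ∧
      R.Pairwise (fun S T => ∀ x ∈ S.1, ∀ y ∈ T.1, SideLTFrom χ s x y) := by
  rw [← pairwise_fromSide χ s] at hD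
  rcases h with h | ⟨rfl, h, -⟩ <;> rw [h] at hD
  · rw [List.pairwise_cons] at hD
    exact ⟨fun x hx S hS y hy => hD.1 S hS x hx y hy, hD.2⟩
  · exact ⟨by simp, hD⟩

end Attach

theorem mem_closed_shift {n : ℕ} (D : LRDiagram n) (X : Finset (Fin (n + 1))) :
    X ∈ D.shift.closed ↔ ∃ Y ∈ D.closed, shiftBlock Y = X := by
  simp [LRDiagram.shift]

section Extend

variable {n : ℕ} {χ : Fin (n + 1) → Side} {ε : Fin (n + 1) → Shade} {D : LRDiagram n}
  {B : Finset (Fin n)} {R : List (Finset (Fin n) × Shade)}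

theorem LRDiagram.Planar.sorted_rest (hD : D.Planar (Fin.tail χ) (Fin.tail ε))
    (h : Attaches (χ 0) (ε 0) D B R) :
    (R.map fun S => (shiftBlock S.1, S.2)).Pairwise
      (fun S T => ∀ x ∈ S.1, ∀ y ∈ T.1, SideLTFrom χ (χ 0) x y) := by
  rw [List.pairwise_map]
  refine (h.sorted hD.sorted).2.imp ?_
  intro S T hST x hx y hy
  obtain ⟨x, rfl⟩ := exists_succ_eq hx
  replace hx := (succ_mem_shiftBlock _ _).1 hx
  obtain ⟨y, rfl⟩ := exists_succ_eq hy
  replace hy := (succ_mem_shiftBlock _ _).1 hy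
  exact sideLTFrom_tail.1 (hST x hx y hy)

theorem LRDiagram.Planar.sorted_new (hD : D.Planar (Fin.tail χ) (Fin.tail ε))
    (h : Attaches (χ 0) (ε 0) D B R) :
    ∀ x ∈ insert 0 (shiftBlock B), ∀ S ∈ R, ∀ y ∈ S.1, SideLTFrom χ (χ 0) x y.succ := by
  intro x hx S hS y hy
  rcases mem_insert.1 hx with rfl | hx
  · exact sideLTFrom_zero χ y
  · obtain ⟨x, rfl⟩ := exists_succ_eq hx
    replace hx := (succ_mem_shiftBlock _ _).1 hx
    exact sideLTFrom_tail.1 ((h.sorted hD.sorted).1 x hx S hS y hy)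

theorem LRDiagram.Planar.hull_closed (hD : D.Planar (Fin.tail χ) (Fin.tail ε))
    {X : Finset (Fin n)} (hX : X ∈ D.closed) {S} (hS : S ∈ D.spines) {y : Fin n} (hy : y ∈ S.1)
    {x z : Fin (n + 1)} (hx : x ∈ shiftBlock X) (hz : z ∈ shiftBlock X) :
    ¬ (SideLT χ x y.succ ∧ SideLT χ y.succ z) := by
  obtain ⟨x, rfl⟩ := exists_succ_eq hx
  replace hx := (succ_mem_shiftBlock _ _).1 hx
  obtain ⟨z, rfl⟩ := exists_succ_eq hz
  replace hz := (succ_mem_shiftBlock _ _).1 hz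
  simpa only [sideLT_tail] using hD.hull X hX S hS x hx y hy z hz

theorem LRDiagram.Planar.hull_new (hD : D.Planar (Fin.tail χ) (Fin.tail ε))
    (h : Attaches (χ 0) (ε 0) D B R)
    {X : Finset (Fin n)} (hX : X ∈ D.closed) {x y z : Fin (n + 1)}
    (hy : y ∈ insert 0 (shiftBlock B)) (hx : x ∈ shiftBlock X) (hz : z ∈ shiftBlock X) :
    ¬ (SideLT χ x y ∧ SideLT χ y z) := by
  rintro ⟨hxy, hyz⟩
  rcases mem_insert.1 hy with rfl | hy
  · exact ne_zero_of_between hxy hyz rfl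
  · obtain ⟨y, rfl⟩ := exists_succ_eq hy
    replace hy := (succ_mem_shiftBlock _ _).1 hy
    exact hD.hull_closed hX (h.mem_nearest hy) hy hx hz ⟨hxy, hyz⟩

theorem LRDiagram.Planar.nonCrossing_shift (hD : D.Planar (Fin.tail χ) (Fin.tail ε))
    {X Y : Finset (Fin n)} (hX : X ∈ D.closed) (hY : Y ∈ D.closed)
    (hXY : shiftBlock X ≠ shiftBlock Y) {a b c d : Fin (n + 1)} (ha : a ∈ shiftBlock X)
    (hc : c ∈ shiftBlock X) (hb : b ∈ shiftBlock Y) (hd : d ∈ shiftBlock Y) :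
    ¬ (SideLT χ a b ∧ SideLT χ b c ∧ SideLT χ c d) := by
  obtain ⟨a, rfl⟩ := exists_succ_eq ha
  replace ha := (succ_mem_shiftBlock _ _).1 ha
  obtain ⟨b, rfl⟩ := exists_succ_eq hb
  replace hb := (succ_mem_shiftBlock _ _).1 hb
  obtain ⟨c, rfl⟩ := exists_succ_eq hc
  replace hc := (succ_mem_shiftBlock _ _).1 hc
  obtain ⟨d, rfl⟩ := exists_succ_eq hd
  replace hd := (succ_mem_shiftBlock _ _).1 hd
  simpa only [sideLT_tail] using
    hD.nonCrossing X hX Y hY (fun e => hXY (by rw [e])) a ha c hc b hb d hd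

theorem LRDiagram.Planar.shade_new (hD : D.Planar (Fin.tail χ) (Fin.tail ε))
    (h : Attaches (χ 0) (ε 0) D B R) : ∀ i ∈ insert 0 (shiftBlock B), ε i = ε 0 := by
  intro i hi
  rcases mem_insert.1 hi with rfl | hi
  · rfl
  · obtain ⟨i, rfl⟩ := exists_succ_eq hi
    replace hi := (succ_mem_shiftBlock _ _).1 hi
    exact hD.shade_spine _ (h.mem_nearest hi) i hi

theorem LRDiagram.Planar.cover_rest (hD : D.Planar (Fin.tail χ) (Fin.tail ε))
    (h : Attaches (χ 0) (ε 0) D B R) (i : Fin (n + 1)) :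
    (∃ X ∈ D.closed, i ∈ shiftBlock X) ∨ i ∈ insert 0 (shiftBlock B) ∨
      ∃ S ∈ R, i ∈ shiftBlock S.1 := by
  induction i using Fin.cases with
  | zero => simp
  | succ i =>
    simp only [succ_mem_shiftBlock, mem_insert, Fin.succ_ne_zero, false_or]
    rcases hD.cover i with hi | ⟨S, hS, hi⟩
    · exact Or.inl hi
    · rcases h.mem_spines hS with rfl | hS
      · exact Or.inr (Or.inl hi)
      · exact Or.inr (Or.inr ⟨S, hS, hi⟩)

theorem LRDiagram.Planar.disjoint_new (hD : D.Planar (Fin.tail χ) (Fin.tail ε))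
    (h : Attaches (χ 0) (ε 0) D B R) {X : Finset (Fin n)} (hX : X ∈ D.closed) {i : Fin (n + 1)}
    (hi : i ∈ shiftBlock X) : i ∉ insert 0 (shiftBlock B) := by
  obtain ⟨i, rfl⟩ := exists_succ_eq hi
  replace hi := (succ_mem_shiftBlock _ _).1 hi
  simp only [succ_mem_shiftBlock, mem_insert, Fin.succ_ne_zero, false_or]
  exact fun hB => hD.disjoint_spine X hX _ (h.mem_nearest hB) i hi hB

theorem LRDiagram.Planar.continuing (hD : D.Planar (Fin.tail χ) (Fin.tail ε))
    (h : Attaches (χ 0) (ε 0) D B R) : (D.continuing (χ 0) (ε 0) B R).Planar χ ε := by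
  have hsp : ∀ S, S ∈ (D.continuing (χ 0) (ε 0) B R).spines ↔
      S = (insert 0 (shiftBlock B), ε 0) ∨ ∃ T ∈ R, (shiftBlock T.1, T.2) = S := by
    intro S
    simp only [LRDiagram.continuing, mem_fromSide, List.mem_cons, List.mem_map]
  have hcl : ∀ X, X ∈ (D.continuing (χ 0) (ε 0) B R).closed ↔
      ∃ Y ∈ D.closed, shiftBlock Y = X := mem_closed_shift D
  constructor
  · intro i
    simp only [hsp, hcl]
    rcases hD.cover_rest h i with ⟨X, hX, hi⟩ | hi | ⟨S, hS, hi⟩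
    · exact Or.inl ⟨_, ⟨X, hX, rfl⟩, hi⟩
    · exact Or.inr ⟨_, Or.inl rfl, hi⟩
    · exact Or.inr ⟨_, Or.inr ⟨S, hS, rfl⟩, hi⟩
  · intro X hX
    obtain ⟨Y, hY, rfl⟩ := (hcl X).1 hX
    exact (hD.nonempty_closed Y hY).map
  · intro S hS
    rcases (hsp S).1 hS with rfl | ⟨T, hT, rfl⟩
    · exact insert_nonempty _ _
    · exact (hD.nonempty_spine T (h.mem_rest hT)).map
  · intro X hX i hi j hj
    obtain ⟨Y, hY, rfl⟩ := (hcl X).1 hX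
    obtain ⟨i, rfl⟩ := exists_succ_eq hi
    replace hi := (succ_mem_shiftBlock _ _).1 hi
    obtain ⟨j, rfl⟩ := exists_succ_eq hj
    replace hj := (succ_mem_shiftBlock _ _).1 hj
    exact hD.shade_closed Y hY i hi j hj
  · intro S hS i hi
    rcases (hsp S).1 hS with rfl | ⟨T, hT, rfl⟩
    · exact hD.shade_new h i hi
    · obtain ⟨i, rfl⟩ := exists_succ_eq hi
      replace hi := (succ_mem_shiftBlock _ _).1 hi
      exact hD.shade_spine T (h.mem_rest hT) i hi
  · intro X hX X' hX' i hi hi'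
    obtain ⟨Y, hY, rfl⟩ := (hcl X).1 hX
    obtain ⟨Y', hY', rfl⟩ := (hcl X').1 hX'
    obtain ⟨i, rfl⟩ := exists_succ_eq hi
    replace hi := (succ_mem_shiftBlock _ _).1 hi
    rw [hD.disjoint_closed Y hY Y' hY' i hi ((succ_mem_shiftBlock _ _).1 hi')]
  · intro X hX S hS i hi hi'
    obtain ⟨Y, hY, rfl⟩ := (hcl X).1 hX
    rcases (hsp S).1 hS with rfl | ⟨T, hT, rfl⟩
    · exact hD.disjoint_new h hY hi hi'
    · obtain ⟨i, rfl⟩ := exists_succ_eq hi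
      replace hi := (succ_mem_shiftBlock _ _).1 hi
      exact hD.disjoint_spine Y hY T (h.mem_rest hT) i hi ((succ_mem_shiftBlock _ _).1 hi')
  · rw [← pairwise_fromSide χ (χ 0)]
    simp only [LRDiagram.continuing, fromSide_fromSide, List.pairwise_cons]
    refine ⟨?_, hD.sorted_rest h⟩
    intro S hS x hx y hy
    obtain ⟨T, hT, rfl⟩ := List.mem_map.1 hS
    obtain ⟨y, rfl⟩ := exists_succ_eq hy
    replace hy := (succ_mem_shiftBlock _ _).1 hy
    exact hD.sorted_new h x hx T hT y hy
  · intro X hX S hS x hx y hy z hz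
    obtain ⟨Y, hY, rfl⟩ := (hcl X).1 hX
    rcases (hsp S).1 hS with rfl | ⟨T, hT, rfl⟩
    · exact hD.hull_new h hY hy hx hz
    · obtain ⟨y, rfl⟩ := exists_succ_eq hy
      replace hy := (succ_mem_shiftBlock _ _).1 hy
      exact hD.hull_closed hY (h.mem_rest hT) hy hx hz
  · intro X hX X' hX' hne a ha c hc b hb d hd
    obtain ⟨Y, hY, rfl⟩ := (hcl X).1 hX
    obtain ⟨Y', hY', rfl⟩ := (hcl X').1 hX'
    exact hD.nonCrossing_shift hY hY' hne ha hc hb hd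

theorem LRDiagram.Planar.ending (hD : D.Planar (Fin.tail χ) (Fin.tail ε))
    (h : Attaches (χ 0) (ε 0) D B R) : (D.ending (χ 0) B R).Planar χ ε := by
  have hsp : ∀ S, S ∈ (D.ending (χ 0) B R).spines ↔ ∃ T ∈ R, (shiftBlock T.1, T.2) = S := by
    intro S
    simp only [LRDiagram.ending, mem_fromSide, List.mem_map]
  have hcl : ∀ X, X ∈ (D.ending (χ 0) B R).closed ↔
      X = insert 0 (shiftBlock B) ∨ ∃ Y ∈ D.closed, shiftBlock Y = X := by
    intro X
    rw [← mem_closed_shift D]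
    simp only [LRDiagram.ending, mem_insert]
  constructor
  · intro i
    simp only [hsp, hcl]
    rcases hD.cover_rest h i with ⟨X, hX, hi⟩ | hi | ⟨S, hS, hi⟩
    · exact Or.inl ⟨_, Or.inr ⟨X, hX, rfl⟩, hi⟩
    · exact Or.inl ⟨_, Or.inl rfl, hi⟩
    · exact Or.inr ⟨_, ⟨S, hS, rfl⟩, hi⟩
  · intro X hX
    rcases (hcl X).1 hX with rfl | ⟨Y, hY, rfl⟩
    · exact insert_nonempty _ _
    · exact (hD.nonempty_closed Y hY).map
  · intro S hS
    obtain ⟨T, hT, rfl⟩ := (hsp S).1 hS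
    exact (hD.nonempty_spine T (h.mem_rest hT)).map
  · intro X hX i hi j hj
    rcases (hcl X).1 hX with rfl | ⟨Y, hY, rfl⟩
    · rw [hD.shade_new h i hi, hD.shade_new h j hj]
    · obtain ⟨i, rfl⟩ := exists_succ_eq hi
      replace hi := (succ_mem_shiftBlock _ _).1 hi
      obtain ⟨j, rfl⟩ := exists_succ_eq hj
      replace hj := (succ_mem_shiftBlock _ _).1 hj
      exact hD.shade_closed Y hY i hi j hj
  · intro S hS i hi
    obtain ⟨T, hT, rfl⟩ := (hsp S).1 hS
    obtain ⟨i, rfl⟩ := exists_succ_eq hi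
    replace hi := (succ_mem_shiftBlock _ _).1 hi
    exact hD.shade_spine T (h.mem_rest hT) i hi
  · intro X hX X' hX' i hi hi'
    rcases (hcl X).1 hX with rfl | ⟨Y, hY, rfl⟩ <;>
      rcases (hcl X').1 hX' with rfl | ⟨Y', hY', rfl⟩
    · rfl
    · exact absurd hi (hD.disjoint_new h hY' hi')
    · exact absurd hi' (hD.disjoint_new h hY hi)
    · obtain ⟨i, rfl⟩ := exists_succ_eq hi
      replace hi := (succ_mem_shiftBlock _ _).1 hi
      rw [hD.disjoint_closed Y hY Y' hY' i hi ((succ_mem_shiftBlock _ _).1 hi')]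
  · intro X hX S hS i hi hi'
    obtain ⟨T, hT, rfl⟩ := (hsp S).1 hS
    obtain ⟨i, rfl⟩ := exists_succ_eq hi'
    replace hi' := (succ_mem_shiftBlock _ _).1 hi'
    rcases (hcl X).1 hX with rfl | ⟨Y, hY, rfl⟩
    · have := hD.sorted_new h _ hi T hT i hi'
      exact this.asymm this
    · exact hD.disjoint_spine Y hY T (h.mem_rest hT) i ((succ_mem_shiftBlock _ _).1 hi) hi'
  · rw [← pairwise_fromSide χ (χ 0)]
    simp only [LRDiagram.ending, fromSide_fromSide]
    exact hD.sorted_rest h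
  · intro X hX S hS x hx y hy z hz
    obtain ⟨T, hT, rfl⟩ := (hsp S).1 hS
    obtain ⟨y, rfl⟩ := exists_succ_eq hy
    replace hy := (succ_mem_shiftBlock _ _).1 hy
    rcases (hcl X).1 hX with rfl | ⟨Y, hY, rfl⟩
    · rintro ⟨hxy, hyz⟩
      have h1 := hD.sorted_new h _ hx T hT y hy
      have h2 := hD.sorted_new h _ hz T hT y hy
      cases hs : χ 0 <;> rw [hs] at h1 h2
      · exact hyz.asymm h2
      · exact hxy.asymm h1
    · exact hD.hull_closed hY (h.mem_rest hT) hy hx hz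
  · intro X hX X' hX' hne a ha c hc b hb d hd
    rcases (hcl X).1 hX with rfl | ⟨Y, hY, rfl⟩ <;>
      rcases (hcl X').1 hX' with rfl | ⟨Y', hY', rfl⟩
    · exact absurd rfl hne
    · exact fun hx => hD.hull_new h hY' hc hb hd hx.2
    · exact fun hx => hD.hull_new h hY hb ha hc ⟨hx.1, hx.2.1⟩
    · exact hD.nonCrossing_shift hY hY' hne ha hc hb hd

end Extend

theorem mem_LR_succ {n : ℕ} {χ : Fin (n + 1) → Side} {ε : Fin (n + 1) → Shade}
    {E : LRDiagram (n + 1)} : E ∈ LR χ ε ↔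
      ∃ D ∈ LR (Fin.tail χ) (Fin.tail ε), E ∈ LRDiagram.extensions (χ 0) (ε 0) D := by
  simp [LR]

theorem planar_of_mem_LR : ∀ {n : ℕ} {χ : Fin n → Side} {ε : Fin n → Shade} {D : LRDiagram n},
    D ∈ LR χ ε → D.Planar χ ε
  | 0, χ, ε, D, hD => by
    obtain rfl : D = ⟨∅, []⟩ := by simpa [LR] using hD
    constructor <;> simp
  | n + 1, χ, ε, E, hE => by
    obtain ⟨D, hD, hED⟩ := mem_LR_succ.1 hE
    obtain ⟨B, R, h, hext⟩ := exists_attaches (χ 0) (ε 0) D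
    rcases (hext E).1 hED with rfl | rfl
    · exact (planar_of_mem_LR hD).ending h
    · exact (planar_of_mem_LR hD).continuing h

/-- Every cut of the block `X` above the node `t` separates two nodes of `X` of the same label, or
nodes of `X` below the cut from a node above the diagram, the labels of these being listed
in `O`. -/
def Uncut {n : ℕ} {α : Type*} (f : Fin n → α) (O : Set α) (X : Finset (Fin n)) : Prop :=
  ∀ t : ℕ, (∃ i ∈ X, (i : ℕ) < t) → (∃ j ∈ X, t ≤ (j : ℕ)) →
    ∃ v ∈ X, t ≤ (v : ℕ) ∧ (f v ∈ O ∨ ∃ u : Fin n, (u : ℕ) < t ∧ f u = f v)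

/-- The labels of the nodes of `X` do not occur outside of `X`. -/
def Saturated {n : ℕ} {α : Type*} (f : Fin n → α) (X : Finset (Fin n)) : Prop :=
  ∀ i ∈ X, ∀ j, f i = f j → j ∈ X

/-- The diagram `D` connects nodes of the same label, and nothing more than it is forced to. The
set `O` lists the labels which occur above the diagram. -/
structure LRDiagram.Minimal {n : ℕ} {α : Type*} (f : Fin n → α) (O : Set α) (D : LRDiagram n) :
    Prop where
  saturated_closed : ∀ X ∈ D.closed, Saturated f X
  saturated_spine : ∀ S ∈ D.spines, Saturated f S.1
  uncut_closed : ∀ X ∈ D.closed, Uncut f O X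
  uncut_spine : ∀ S ∈ D.spines, Uncut f O S.1
  closed_notMem : ∀ X ∈ D.closed, ∀ i ∈ X, f i ∉ O
  spine_mem : ∀ S ∈ D.spines, ∃ i ∈ S.1, f i ∈ O

/-- A labelling is compatible with `χ` if its level sets do not cross, neither with each other nor
with chords to the top. -/
structure NonCrossingLabels {n : ℕ} {α : Type*} (χ : Fin n → Side) (f : Fin n → α) (O : Set α) :
    Prop where
  nonCrossing : ∀ a b c d, SideLT χ a b → SideLT χ b c → SideLT χ c d → f a = f c → f b = f d →
    f a = f b
  top : ∀ a b c, SideLT χ a b → SideLT χ b c → f a = f c → f b ∈ O → f b = f a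

section

variable {n : ℕ} {α : Type*} {χ : Fin (n + 1) → Side} {f : Fin (n + 1) → α} {O : Set α}

theorem NonCrossingLabels.tail (h : NonCrossingLabels χ f O) :
    NonCrossingLabels (Fin.tail χ) (Fin.tail f) (insert (f 0) O) := by
  constructor
  · intro a b c d
    simp only [sideLT_tail]
    exact h.nonCrossing _ _ _ _
  · intro a b c
    simp only [sideLT_tail]
    rintro hab hbc hac (hb | hb)
    · have h0 := sideLTFrom_zero χ a
      have h0' := sideLTFrom_zero χ c
      cases hs : χ 0 <;> rw [hs] at h0 h0'
      · exact hb.trans (h.nonCrossing _ _ _ _ h0 hab hbc hb.symm hac)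
      · exact (h.nonCrossing _ _ _ _ hab hbc h0' hac hb).symm
    · exact h.top _ _ _ hab hbc hac hb

theorem uncut_shiftBlock_iff {X : Finset (Fin n)} (hX : ∀ i ∈ X, f i.succ ≠ f 0) :
    Uncut f O (shiftBlock X) ↔ Uncut (Fin.tail f) (insert (f 0) O) X := by
  constructor
  · rintro h t ⟨i, hi, hit⟩ ⟨j, hj, htj⟩
    obtain ⟨v, hv, htv, hfv⟩ := h (t + 1) ⟨i.succ, (succ_mem_shiftBlock _ _).2 hi, by simpa⟩
      ⟨j.succ, (succ_mem_shiftBlock _ _).2 hj, by simpa⟩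
    obtain ⟨v, rfl⟩ := exists_succ_eq hv
    refine ⟨v, (succ_mem_shiftBlock _ _).1 hv, by simpa using htv, ?_⟩
    rcases hfv with hfv | ⟨u, hu, huv⟩
    · exact Or.inl (Or.inr hfv)
    · induction u using Fin.cases with
      | zero => exact Or.inl (Or.inl huv.symm)
      | succ u => exact Or.inr ⟨u, by simpa using hu, huv⟩
  · rintro h t ⟨i, hi, hit⟩ ⟨j, hj, htj⟩
    obtain ⟨i, rfl⟩ := exists_succ_eq hi
    obtain ⟨j, rfl⟩ := exists_succ_eq hj
    rw [Fin.val_succ] at hit htj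
    obtain ⟨v, hv, htv, hfv⟩ := h (t - 1) ⟨i, (succ_mem_shiftBlock _ _).1 hi, by omega⟩
      ⟨j, (succ_mem_shiftBlock _ _).1 hj, by omega⟩
    refine ⟨v.succ, (succ_mem_shiftBlock _ _).2 hv, by rw [Fin.val_succ]; omega, ?_⟩
    rcases hfv with (hfv | hfv) | ⟨u, hu, huv⟩
    · exact absurd hfv (hX v hv)
    · exact Or.inl hfv
    · exact Or.inr ⟨u.succ, by rw [Fin.val_succ]; omega, huv⟩

theorem saturated_shiftBlock_iff {X : Finset (Fin n)} (hX : ∀ i ∈ X, f i.succ ≠ f 0) :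
    Saturated f (shiftBlock X) ↔ Saturated (Fin.tail f) X := by
  constructor
  · intro h i hi j hij
    exact (succ_mem_shiftBlock _ _).1 (h _ ((succ_mem_shiftBlock _ _).2 hi) j.succ hij)
  · intro h i hi j hij
    obtain ⟨i, rfl⟩ := exists_succ_eq hi
    replace hi := (succ_mem_shiftBlock _ _).1 hi
    induction j using Fin.cases with
    | zero => exact absurd hij (hX i hi)
    | succ j => exact (succ_mem_shiftBlock _ _).2 (h i hi j hij)

theorem Saturated.ne_of_shiftBlock {X : Finset (Fin n)} (h : Saturated f (shiftBlock X)) :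
    ∀ i ∈ X, f i.succ ≠ f 0 := fun _ hi e =>
  zero_notMem_shiftBlock X (h _ ((succ_mem_shiftBlock _ _).2 hi) 0 e)

theorem Saturated.of_insert_zero {B : Finset (Fin n)}
    (h : Saturated f (insert 0 (shiftBlock B))) : Saturated (Fin.tail f) B := by
  intro i hi j hij
  simpa using h i.succ (by simpa using hi) j.succ hij

theorem Uncut.of_insert_zero {B : Finset (Fin n)} (h : Uncut f O (insert 0 (shiftBlock B)))
    (t : ℕ) (ht : ∃ j ∈ B, t ≤ (j : ℕ)) : ∃ v ∈ B, t ≤ (v : ℕ) ∧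
      (f v.succ ∈ insert (f 0) O ∨ ∃ u : Fin n, (u : ℕ) < t ∧ f u.succ = f v.succ) := by
  obtain ⟨j, hj, htj⟩ := ht
  obtain ⟨v, hv, htv, hfv⟩ := h (t + 1) ⟨0, mem_insert_self _ _, by simp⟩
    ⟨j.succ, by simpa using hj, by simpa using htj⟩
  induction v using Fin.cases with
  | zero => simp at htv
  | succ v =>
    refine ⟨v, by simpa using hv, by simpa using htv, ?_⟩
    rcases hfv with hfv | ⟨u, hu, huv⟩
    · exact Or.inl (Or.inr hfv)
    · induction u using Fin.cases with
      | zero => exact Or.inl (Or.inl huv.symm)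
      | succ u => exact Or.inr ⟨u, by simpa using hu, huv⟩

theorem Uncut.insert_zero {B : Finset (Fin n)} (h : Uncut (Fin.tail f) (insert (f 0) O) B)
    (hB : B.Nonempty → ∃ i ∈ B, f i.succ ∈ insert (f 0) O) :
    Uncut f O (insert 0 (shiftBlock B)) := by
  rintro t ⟨i, -, hit⟩ ⟨j, hj, htj⟩
  induction j using Fin.cases with
  | zero => simp at htj; omega
  | succ j =>
    replace hj : j ∈ B := by simpa using hj
    rw [Fin.val_succ] at htj
    obtain ⟨v, hv, htv, hfv⟩ : ∃ v ∈ B, t ≤ (v : ℕ) + 1 ∧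
        (f v.succ ∈ insert (f 0) O ∨ ∃ u : Fin n, (u : ℕ) < t - 1 ∧ f u.succ = f v.succ) := by
      by_cases hi : ∃ i ∈ B, (i : ℕ) < t - 1
      · obtain ⟨v, hv, htv, hfv⟩ := h (t - 1) hi ⟨j, hj, by omega⟩
        exact ⟨v, hv, by omega, hfv⟩
      · push Not at hi
        obtain ⟨v, hv, hfv⟩ := hB ⟨j, hj⟩
        exact ⟨v, hv, by have := hi v hv; omega, Or.inl hfv⟩
    refine ⟨v.succ, by simpa using hv, by simpa using htv, ?_⟩
    rcases hfv with (hfv | hfv) | ⟨u, hu, huv⟩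
    · exact Or.inr ⟨0, by simp; omega, hfv.symm⟩
    · exact Or.inl hfv
    · exact Or.inr ⟨u.succ, by rw [Fin.val_succ]; omega, huv⟩

end

section

variable {n : ℕ} {α : Type*} {χ : Fin (n + 1) → Side} {ε : Fin (n + 1) → Shade}
  {f : Fin (n + 1) → α} {O : Set α} {D : LRDiagram n} {B : Finset (Fin n)}
  {R : List (Finset (Fin n) × Shade)}

/-- What `Minimal` says about an extension of `D`, apart from whether its new block is closed. -/
theorem minimal_tail_of_extension (hD : D.Planar (Fin.tail χ) (Fin.tail ε))
    (h : Attaches (χ 0) (ε 0) D B R)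
    (hc : ∀ X ∈ D.closed, Saturated f (shiftBlock X) ∧ Uncut f O (shiftBlock X) ∧
      ∀ i ∈ shiftBlock X, f i ∉ O)
    (hR : ∀ S ∈ R, Saturated f (shiftBlock S.1) ∧ Uncut f O (shiftBlock S.1) ∧
      ∃ i ∈ shiftBlock S.1, f i ∈ O)
    (hB : Saturated f (insert 0 (shiftBlock B)) ∧ Uncut f O (insert 0 (shiftBlock B))) :
    D.Minimal (Fin.tail f) (insert (f 0) O) := by
  have hsp : ∀ S ∈ D.spines, Saturated (Fin.tail f) S.1 ∧
      Uncut (Fin.tail f) (insert (f 0) O) S.1 ∧ ∃ i ∈ S.1, Fin.tail f i ∈ insert (f 0) O := by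
    intro S hS
    rcases h.mem_spines hS with rfl | hSR
    · obtain ⟨j, hj⟩ := hD.nonempty_spine _ hS
      refine ⟨hB.1.of_insert_zero, fun t _ ht => hB.2.of_insert_zero t ht, ?_⟩
      obtain ⟨v, hv, -, hfv | ⟨u, hu, -⟩⟩ := hB.2.of_insert_zero 0 ⟨j, hj, Nat.zero_le _⟩
      · exact ⟨v, hv, hfv⟩
      · exact absurd hu (Nat.not_lt_zero _)
    · obtain ⟨h1, h2, i, hi, hfi⟩ := hR S hSR
      refine ⟨(saturated_shiftBlock_iff h1.ne_of_shiftBlock).1 h1,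
        (uncut_shiftBlock_iff h1.ne_of_shiftBlock).1 h2, ?_⟩
      obtain ⟨i, rfl⟩ := exists_succ_eq hi
      exact ⟨i, (succ_mem_shiftBlock _ _).1 hi, Or.inr hfi⟩
  constructor
  · intro X hX
    have h1 := (hc X hX).1
    exact (saturated_shiftBlock_iff h1.ne_of_shiftBlock).1 h1
  · exact fun S hS => (hsp S hS).1
  · intro X hX
    have h1 := (hc X hX).1
    exact (uncut_shiftBlock_iff h1.ne_of_shiftBlock).1 (hc X hX).2.1
  · exact fun S hS => (hsp S hS).2.1
  · rintro X hX i hi (hfi | hfi)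
    · exact (hc X hX).1.ne_of_shiftBlock i hi hfi
    · exact (hc X hX).2.2 _ ((succ_mem_shiftBlock _ _).2 hi) hfi
  · exact fun S hS => (hsp S hS).2.2

/-- A spine containing a node with the label of the new node is the one the new node is
connected to. -/
theorem LRDiagram.Minimal.ne_of_mem_rest (hD : D.Planar (Fin.tail χ) (Fin.tail ε))
    (h : Attaches (χ 0) (ε 0) D B R) (hm : D.Minimal (Fin.tail f) (insert (f 0) O))
    (hf : NonCrossingLabels χ f O) (hε : ∀ i j, f i = f j → ε i = ε j) :
    ∀ S ∈ R, ∀ i ∈ S.1, f i.succ ≠ f 0 := by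
  intro S hS v hv hfv
  have key : ∀ T ∈ D.spines, (∀ x ∈ T.1, ∀ y ∈ S.1, SideLTFrom (Fin.tail χ) (χ 0) x y) →
      False := by
    intro T hT hTS
    obtain ⟨w, hw, hfw⟩ := hm.spine_mem T hT
    have hwv := sideLTFrom_tail.1 (hTS w hw v hv)
    have h0w := sideLTFrom_zero χ w
    have hne : f w.succ ≠ f 0 := by
      intro e
      have hwS : w ∈ S.1 := hm.saturated_spine S (h.mem_rest hS) v hv w (hfv.trans e.symm)
      have := hTS w hw w hwS
      exact this.asymm this
    have hfw' : f w.succ ∈ O := hfw.resolve_left hne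
    cases hs : χ 0 <;> rw [hs] at hwv h0w
    · exact hne (hf.top _ _ _ h0w hwv hfv.symm hfw')
    · exact hne ((hf.top _ _ _ hwv h0w hfv hfw').trans hfv)
  rcases h with h | ⟨-, h, hhead⟩
  · have hBD : (B, ε 0) ∈ D.spines := by
      rw [← mem_fromSide (χ 0), h]; exact List.mem_cons_self
    refine key _ hBD fun x hx y hy => ?_
    exact (Attaches.sorted (Or.inl h) hD.sorted).1 x hx S hS y hy
  · cases R with
    | nil => simp at hS
    | cons T R =>
      have hTD : ∀ U ∈ T :: R, U ∈ D.spines := by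
        intro U hU
        rwa [← mem_fromSide (χ 0), h]
      rcases List.mem_cons.1 hS with rfl | hS'
      · have h1 := hD.shade_spine S (hTD S hS) v hv
        have h2 : ε v.succ = ε 0 := hε _ _ hfv
        exact hhead S (by simp) (h1.symm.trans h2)
      · have := hD.sorted
        rw [← pairwise_fromSide _ (χ 0), h, List.pairwise_cons] at this
        exact key T (hTD T List.mem_cons_self) (this.1 S hS')

theorem LRDiagram.Minimal.extension (hD : D.Planar (Fin.tail χ) (Fin.tail ε))
    (h : Attaches (χ 0) (ε 0) D B R) (hm : D.Minimal (Fin.tail f) (insert (f 0) O))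
    (hf : NonCrossingLabels χ f O) (hε : ∀ i j, f i = f j → ε i = ε j) :
    (∀ X ∈ D.closed, Saturated f (shiftBlock X) ∧ Uncut f O (shiftBlock X) ∧
      ∀ i ∈ shiftBlock X, f i ∉ O) ∧
    (∀ S ∈ R, Saturated f (shiftBlock S.1) ∧ Uncut f O (shiftBlock S.1) ∧
      ∃ i ∈ shiftBlock S.1, f i ∈ O) ∧
    Saturated f (insert 0 (shiftBlock B)) ∧ Uncut f O (insert 0 (shiftBlock B)) := by
  have hR := hm.ne_of_mem_rest hD h hf hε
  have hC : ∀ X ∈ D.closed, ∀ i ∈ X, f i.succ ≠ f 0 := fun X hX i hi e =>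
    hm.closed_notMem X hX i hi (Or.inl e)
  refine ⟨fun X hX => ⟨(saturated_shiftBlock_iff (hC X hX)).2 (hm.saturated_closed X hX),
    (uncut_shiftBlock_iff (hC X hX)).2 (hm.uncut_closed X hX), ?_⟩, fun S hS =>
    ⟨(saturated_shiftBlock_iff (hR S hS)).2 (hm.saturated_spine S (h.mem_rest hS)),
    (uncut_shiftBlock_iff (hR S hS)).2 (hm.uncut_spine S (h.mem_rest hS)), ?_⟩, ?_, ?_⟩
  · intro i hi hfi
    obtain ⟨i, rfl⟩ := exists_succ_eq hi
    exact hm.closed_notMem X hX i ((succ_mem_shiftBlock _ _).1 hi) (Or.inr hfi)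
  · obtain ⟨i, hi, hfi⟩ := hm.spine_mem S (h.mem_rest hS)
    exact ⟨i.succ, (succ_mem_shiftBlock _ _).2 hi, hfi.resolve_left (hR S hS i hi)⟩
  · intro i hi j hij
    induction j using Fin.cases with
    | zero => exact mem_insert_self _ _
    | succ j =>
      induction i using Fin.cases with
      | zero =>
        rcases hD.cover j with ⟨X, hX, hj⟩ | ⟨S, hS, hj⟩
        · exact absurd hij.symm (hC X hX j hj)
        · rcases h.mem_spines hS with rfl | hS
          · simpa using hj
          · exact absurd hij.symm (hR S hS j hj)
      | succ i =>
        replace hi : i ∈ B := by simpa using hi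
        simpa using hm.saturated_spine _ (h.mem_nearest hi) i hi j hij
  · rcases B.eq_empty_or_nonempty with rfl | ⟨i, hi⟩
    · exact Uncut.insert_zero (fun t ⟨i, hi, _⟩ => by simp at hi) (by simp)
    · exact Uncut.insert_zero (hm.uncut_spine _ (h.mem_nearest hi))
        fun _ => hm.spine_mem _ (h.mem_nearest hi)

theorem minimal_continuing_iff : (D.continuing (χ 0) (ε 0) B R).Minimal f O ↔
    ((∀ X ∈ D.closed, Saturated f (shiftBlock X) ∧ Uncut f O (shiftBlock X) ∧
      ∀ i ∈ shiftBlock X, f i ∉ O) ∧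
    (∀ S ∈ R, Saturated f (shiftBlock S.1) ∧ Uncut f O (shiftBlock S.1) ∧
      ∃ i ∈ shiftBlock S.1, f i ∈ O) ∧
    Saturated f (insert 0 (shiftBlock B)) ∧ Uncut f O (insert 0 (shiftBlock B))) ∧
    ∃ i ∈ insert 0 (shiftBlock B), f i ∈ O := by
  have hsp : ∀ S, S ∈ (D.continuing (χ 0) (ε 0) B R).spines ↔
      S = (insert 0 (shiftBlock B), ε 0) ∨ ∃ T ∈ R, (shiftBlock T.1, T.2) = S := by
    intro S
    simp only [LRDiagram.continuing, mem_fromSide, List.mem_cons, List.mem_map]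
  have hcl : ∀ X, X ∈ (D.continuing (χ 0) (ε 0) B R).closed ↔
      ∃ Y ∈ D.closed, shiftBlock Y = X := mem_closed_shift D
  constructor
  · rintro ⟨h1, h2, h3, h4, h5, h6⟩
    have hN := (hsp _).2 (Or.inl rfl)
    exact ⟨⟨fun X hX => have hX' := (hcl _).2 ⟨X, hX, rfl⟩; ⟨h1 _ hX', h3 _ hX', h5 _ hX'⟩,
      fun S hS => have hS' := (hsp _).2 (Or.inr ⟨S, hS, rfl⟩); ⟨h2 _ hS', h4 _ hS', h6 _ hS'⟩,
      h2 _ hN, h4 _ hN⟩, h6 _ hN⟩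
  · rintro ⟨⟨h1, h2, h3, h4⟩, h5⟩
    constructor <;> intro X hX
    · obtain ⟨Y, hY, rfl⟩ := (hcl X).1 hX; exact (h1 Y hY).1
    · rcases (hsp X).1 hX with rfl | ⟨T, hT, rfl⟩
      exacts [h3, (h2 T hT).1]
    · obtain ⟨Y, hY, rfl⟩ := (hcl X).1 hX; exact (h1 Y hY).2.1
    · rcases (hsp X).1 hX with rfl | ⟨T, hT, rfl⟩
      exacts [h4, (h2 T hT).2.1]
    · obtain ⟨Y, hY, rfl⟩ := (hcl X).1 hX; exact (h1 Y hY).2.2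
    · rcases (hsp X).1 hX with rfl | ⟨T, hT, rfl⟩
      exacts [h5, (h2 T hT).2.2]

theorem minimal_ending_iff : (D.ending (χ 0) B R).Minimal f O ↔
    ((∀ X ∈ D.closed, Saturated f (shiftBlock X) ∧ Uncut f O (shiftBlock X) ∧
      ∀ i ∈ shiftBlock X, f i ∉ O) ∧
    (∀ S ∈ R, Saturated f (shiftBlock S.1) ∧ Uncut f O (shiftBlock S.1) ∧
      ∃ i ∈ shiftBlock S.1, f i ∈ O) ∧
    Saturated f (insert 0 (shiftBlock B)) ∧ Uncut f O (insert 0 (shiftBlock B))) ∧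
    ¬ ∃ i ∈ insert 0 (shiftBlock B), f i ∈ O := by
  have hsp : ∀ S, S ∈ (D.ending (χ 0) B R).spines ↔ ∃ T ∈ R, (shiftBlock T.1, T.2) = S := by
    intro S
    simp only [LRDiagram.ending, mem_fromSide, List.mem_map]
  have hcl : ∀ X, X ∈ (D.ending (χ 0) B R).closed ↔
      X = insert 0 (shiftBlock B) ∨ ∃ Y ∈ D.closed, shiftBlock Y = X := by
    intro X
    rw [← mem_closed_shift D]
    simp only [LRDiagram.ending, mem_insert]
  constructor
  · rintro ⟨h1, h2, h3, h4, h5, h6⟩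
    have hN := (hcl _).2 (Or.inl rfl)
    exact ⟨⟨fun X hX => have hX' := (hcl _).2 (Or.inr ⟨X, hX, rfl⟩);
      ⟨h1 _ hX', h3 _ hX', h5 _ hX'⟩,
      fun S hS => have hS' := (hsp _).2 ⟨S, hS, rfl⟩; ⟨h2 _ hS', h4 _ hS', h6 _ hS'⟩,
      h1 _ hN, h3 _ hN⟩, fun ⟨i, hi, hfi⟩ => h5 _ hN i hi hfi⟩
  · rintro ⟨⟨h1, h2, h3, h4⟩, h5⟩
    constructor <;> intro X hX
    · rcases (hcl X).1 hX with rfl | ⟨Y, hY, rfl⟩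
      exacts [h3, (h1 Y hY).1]
    · obtain ⟨T, hT, rfl⟩ := (hsp X).1 hX; exact (h2 T hT).1
    · rcases (hcl X).1 hX with rfl | ⟨Y, hY, rfl⟩
      exacts [h4, (h1 Y hY).2.1]
    · obtain ⟨T, hT, rfl⟩ := (hsp X).1 hX; exact (h2 T hT).2.1
    · rcases (hcl X).1 hX with rfl | ⟨Y, hY, rfl⟩
      exacts [fun i hi hfi => h5 ⟨i, hi, hfi⟩, (h1 Y hY).2.2]
    · obtain ⟨T, hT, rfl⟩ := (hsp X).1 hX; exact (h2 T hT).2.2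

end

theorem existsUnique_minimal {α : Type*} : ∀ {n : ℕ} (χ : Fin n → Side) (ε : Fin n → Shade)
    (f : Fin n → α) (O : Set α), NonCrossingLabels χ f O → (∀ i j, f i = f j → ε i = ε j) →
    ∃! D, D ∈ LR χ ε ∧ D.Minimal f O
  | 0, χ, ε, f, O, _, _ => by
    refine ⟨⟨∅, []⟩, ⟨by simp [LR], by constructor <;> simp⟩, ?_⟩
    rintro D ⟨hD, -⟩
    simpa [LR] using hD
  | n + 1, χ, ε, f, O, hf, hε => by
    obtain ⟨D, ⟨hD, hm⟩, huniq⟩ := existsUnique_minimal (Fin.tail χ) (Fin.tail ε) (Fin.tail f)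
      (insert (f 0) O) hf.tail fun i j => hε i.succ j.succ
    obtain ⟨B, R, h, hext⟩ := exists_attaches (χ 0) (ε 0) D
    have hall := hm.extension (planar_of_mem_LR hD) h hf hε
    have hback : ∀ E, E ∈ LR χ ε ∧ E.Minimal f O →
        E ∈ LRDiagram.extensions (χ 0) (ε 0) D := by
      rintro E ⟨hE, hEm⟩
      obtain ⟨D', hD', hE⟩ := mem_LR_succ.1 hE
      obtain ⟨B', R', h', hext'⟩ := exists_attaches (χ 0) (ε 0) D'
      have hm' : D'.Minimal (Fin.tail f) (insert (f 0) O) := by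
        rcases (hext' E).1 hE with rfl | rfl
        · obtain ⟨⟨h1, h2, h3⟩, -⟩ := minimal_ending_iff.1 hEm
          exact minimal_tail_of_extension (planar_of_mem_LR hD') h' h1 h2 h3
        · obtain ⟨⟨h1, h2, h3⟩, -⟩ := minimal_continuing_iff.1 hEm
          exact minimal_tail_of_extension (planar_of_mem_LR hD') h' h1 h2 h3
      rwa [← huniq D' ⟨hD', hm'⟩]
    by_cases hO : ∃ i ∈ insert 0 (shiftBlock B), f i ∈ O
    · refine ⟨D.continuing (χ 0) (ε 0) B R, ⟨mem_LR_succ.2 ⟨D, hD, (hext _).2 (Or.inr rfl)⟩,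
        minimal_continuing_iff.2 ⟨hall, hO⟩⟩, fun E hE => ?_⟩
      rcases (hext E).1 (hback E hE) with rfl | rfl
      · exact absurd hO (minimal_ending_iff.1 hE.2).2
      · rfl
    · refine ⟨D.ending (χ 0) B R, ⟨mem_LR_succ.2 ⟨D, hD, (hext _).2 (Or.inl rfl)⟩,
        minimal_ending_iff.2 ⟨hall, hO⟩⟩, fun E hE => ?_⟩
      rcases (hext E).1 (hback E hE) with rfl | rfl
      · rfl
      · exact absurd (minimal_continuing_iff.1 hE.2).2 hO

section Part

variable {n : ℕ} {π σ ρ : NodePartition n}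

theorem mem_part_iff_eq (π : NodePartition n) {i j : Fin n} : j ∈ π.part i ↔ π.part j = π.part i :=
  π.mem_part_iff_part_eq_part (mem_univ j) (mem_univ i)

theorem le_iff_part_eq : π ≤ σ ↔ ∀ i j, π.part i = π.part j → σ.part i = σ.part j := by
  constructor
  · intro h i j hij
    obtain ⟨U, hU, hsub⟩ := h (π.part_mem.2 (mem_univ i))
    rw [σ.part_eq_of_mem hU (hsub (π.mem_part (mem_univ i))),
      σ.part_eq_of_mem hU (hsub (hij ▸ π.mem_part (mem_univ j)))]
  · intro h V hV
    obtain ⟨i, hi⟩ := π.nonempty_of_mem_parts hV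
    refine ⟨σ.part i, σ.part_mem.2 (mem_univ i), fun j hj => ?_⟩
    rw [mem_part_iff_eq]
    exact h j i (by rw [π.part_eq_of_mem hV hi, π.part_eq_of_mem hV hj])

theorem eq_of_part_eq_iff (h : ∀ i j, π.part i = π.part j ↔ σ.part i = σ.part j) : π = σ :=
  le_antisymm (le_iff_part_eq.2 fun i j => (h i j).1) (le_iff_part_eq.2 fun i j => (h i j).2)

theorem part_ofSetoid_eq_iff (s : Setoid (Fin n)) [DecidableRel s.r] (i j : Fin n) :
    (Finpartition.ofSetoid s).part i = (Finpartition.ofSetoid s).part j ↔ s i j := by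
  rw [← mem_part_iff_eq, Finpartition.mem_part_ofSetoid_iff_rel]
  exact ⟨s.symm', s.symm'⟩

theorem le_shadingPartition_iff {ε : Fin n → Shade} :
    π ≤ shadingPartition ε ↔ ∀ i j, π.part i = π.part j → ε i = ε j := by
  rw [le_iff_part_eq]
  unfold shadingPartition
  simp only [part_ofSetoid_eq_iff]
  rfl

/-- Lateral refinement: within a block of `σ`, the blocks of `π` are intervals. -/
theorem lateralRefinement_iff : LateralRefinement π σ ↔ π ≤ σ ∧ ∀ i j k, i ≤ j → j ≤ k →
    σ.part i = σ.part j → π.part i = π.part k → π.part i = π.part j := by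
  refine and_congr_right fun hle => ⟨?_, ?_⟩
  · intro h i j k hij hjk hσ hπ
    by_contra hne
    have hi := π.mem_part (mem_univ i)
    have hj := π.mem_part (mem_univ j)
    have hk : k ∈ π.part i := hπ ▸ π.mem_part (mem_univ k)
    have hle' := le_iff_part_eq.1 hle
    refine h _ (π.part_mem.2 (mem_univ i)) _ (π.part_mem.2 (mem_univ j)) hne
      ⟨⟨i, hi⟩, ⟨j, hj⟩, ?_⟩ ⟨σ.part i, σ.part_mem.2 (mem_univ i), ?_, ?_⟩
    · refine max_le (le_min ?_ ?_) (le_min ?_ ?_)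
      · exact (min'_le _ _ hi).trans (le_max' _ _ hi)
      · exact ((min'_le _ _ hi).trans hij).trans (le_max' _ _ hj)
      · exact ((min'_le _ _ hj).trans hjk).trans (le_max' _ _ hk)
      · exact (min'_le _ _ hj).trans (le_max' _ _ hj)
    · intro x hx
      rw [mem_part_iff_eq] at hx ⊢
      exact hle' _ _ hx
    · intro x hx
      rw [mem_part_iff_eq] at hx ⊢
      exact (hle' _ _ hx).trans hσ.symm
  · intro h
    have key : ∀ V ∈ π.parts, ∀ W ∈ π.parts, V ≠ W → ∀ U ∈ σ.parts, V ⊆ U → W ⊆ U →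
        ∀ i ∈ V, ∀ j ∈ W, ∀ k ∈ V, i ≤ j → j ≤ k → False := by
      intro V hV W hW hne U hU hVU hWU i hi j hj k hk hij hjk
      have := h i j k hij hjk (by rw [σ.part_eq_of_mem hU (hVU hi), σ.part_eq_of_mem hU (hWU hj)])
        (by rw [π.part_eq_of_mem hV hi, π.part_eq_of_mem hV hk])
      rw [π.part_eq_of_mem hV hi, π.part_eq_of_mem hW hj] at this
      exact hne this
    rintro V hV W hW hne ⟨hV', hW', hp⟩ ⟨U, hU, hVU, hWU⟩
    obtain ⟨h1, h2⟩ := max_le_iff.1 hp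
    rcases le_total (V.min' hV') (W.min' hW') with h3 | h3
    · exact key V hV W hW hne U hU hVU hWU _ (min'_mem _ _) _ (min'_mem _ _) _ (max'_mem _ _) h3
        (h2.trans (min_le_left _ _))
    · exact key W hW V hV hne.symm U hU hWU hVU _ (min'_mem _ _) _ (min'_mem _ _) _ (max'_mem _ _)
        h3 (h1.trans (min_le_right _ _))

theorem LateralRefinement.isBiNonCrossing {χ : Fin n → Side} (h : LateralRefinement π σ)
    (hσ : IsBiNonCrossing χ σ) : IsBiNonCrossing χ π := by
  obtain ⟨hle, hconv⟩ := lateralRefinement_iff.1 h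
  rw [le_iff_part_eq] at hle
  rw [isBiNonCrossing_iff]
  rintro V hV W hW hne a ha c hc b hb d hd ⟨hab, hbc, hcd⟩
  have hac : π.part a = π.part c := by rw [π.part_eq_of_mem hV ha, π.part_eq_of_mem hV hc]
  have hbd : π.part b = π.part d := by rw [π.part_eq_of_mem hW hb, π.part_eq_of_mem hW hd]
  have hne' : π.part a ≠ π.part b := by
    rwa [π.part_eq_of_mem hV ha, π.part_eq_of_mem hW hb]
  have hσab := hσ.part_eq hab hbc hcd (hle _ _ hac) (hle _ _ hbd)
  have hσac := hle _ _ hac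
  have hσbd := hle _ _ hbd
  have key : (a < b ∧ c < b ∧ c < d) ∨ (b < a ∧ b < c) := by
    have hbc_ne : b ≠ c := fun e => hne' (by rw [hac, e])
    have hab_ne : a ≠ b := fun e => hne' (by rw [e])
    have hcd_ne : c ≠ d := fun e => hne' (by rw [hac, hbd, e])
    rcases lt_or_gt_of_ne hbc_ne with h1 | h1
    · right
      refine ⟨?_, h1⟩
      by_contra h2
      exact hne' (hconv a b c (not_lt.1 h2) h1.le hσab hac)
    · left
      refine ⟨?_, h1, ?_⟩
      · by_contra h2
        refine hne' ?_
        have := hconv c b a h1.le (not_lt.1 h2) (hσac.symm.trans hσab) hac.symm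
        exact hac.trans this
      · by_contra h2
        refine hne' ?_
        have := hconv d c b (not_lt.1 h2) h1.le
          (hσbd.symm.trans (hσab.symm.trans hσac)) hbd.symm
        exact hac.trans (this.symm.trans hbd.symm)
  rcases key with ⟨h1, h2, h3⟩ | ⟨h1, h2⟩
  · rcases hbc with hbc | hbc
    · exact lt_asymm h2 hbc.1
    · rcases hcd with hcd | hcd
      · rw [hbc.2] at hcd; cases hcd.2
      · exact lt_asymm h3 hcd.1
  · rcases hab with hab | hab
    · exact lt_asymm h1 hab.1
    · rcases hbc with hbc | hbc
      · rw [hab.2] at hbc; cases hbc.2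
      · exact lt_asymm h2 hbc.1

/-- The top nodes of the blocks. -/
def blockTops (π : NodePartition n) : Finset (Fin n) :=
  univ.filter fun m => ∀ j, π.part j = π.part m → m ≤ j

theorem mem_blockTops {m : Fin n} : m ∈ blockTops π ↔ ∀ j, π.part j = π.part m → m ≤ j := by
  simp [blockTops]

theorem exists_blockTop (π : NodePartition n) (i : Fin n) :
    ∃ m ∈ blockTops π, π.part m = π.part i ∧ m ≤ i := by
  have hne : (π.part i).Nonempty := ⟨i, π.mem_part (mem_univ i)⟩
  have hm : π.part ((π.part i).min' hne) = π.part i := (mem_part_iff_eq π).1 (min'_mem _ hne)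
  refine ⟨(π.part i).min' hne, mem_blockTops.2 fun j hj => ?_, hm,
    min'_le _ _ (π.mem_part (mem_univ i))⟩
  exact min'_le _ _ ((mem_part_iff_eq π).2 (hj.trans hm))

theorem card_blockTops (π : NodePartition n) : #(blockTops π) = #π.parts := by
  refine card_bij (fun m _ => π.part m) (fun m _ => π.part_mem.2 (mem_univ m)) ?_ ?_
  · intro m hm m' hm' h
    exact le_antisymm (mem_blockTops.1 hm m' h.symm) (mem_blockTops.1 hm' m h)
  · intro V hV
    obtain ⟨i, hi⟩ := π.nonempty_of_mem_parts hV
    obtain ⟨m, hm, hmi, -⟩ := exists_blockTop π i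
    exact ⟨m, hm, hmi.trans (π.part_eq_of_mem hV hi)⟩

theorem blockTops_subset (h : π ≤ σ) : blockTops σ ⊆ blockTops π := by
  intro m hm
  exact mem_blockTops.2 fun j hj => mem_blockTops.1 hm j (le_iff_part_eq.1 h _ _ hj)

/-- The nodes above which the blocks of `σ` can be cut without cutting a block of `ρ`. -/
def cutNodes (ρ σ : NodePartition n) : Finset (Fin n) :=
  univ.filter fun m => m ∉ blockTops σ ∧
    ∀ i j, σ.part i = σ.part m → ρ.part i = ρ.part j → m ≤ i → m ≤ j

theorem mem_cutNodes {m : Fin n} : m ∈ cutNodes ρ σ ↔ m ∉ blockTops σ ∧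
    ∀ i j, σ.part i = σ.part m → ρ.part i = ρ.part j → m ≤ i → m ≤ j := by
  simp [cutNodes]

/-- The partition obtained from `σ` by cutting its blocks above the nodes in `M`. -/
noncomputable def cutAbove (σ : NodePartition n) (M : Finset (Fin n)) : NodePartition n :=
  open Classical in
  Finpartition.ofSetoid
    (Setoid.ker fun i => (σ.part i, M.filter fun m => σ.part m = σ.part i ∧ m ≤ i))

theorem part_cutAbove_eq_iff {M : Finset (Fin n)} {i j : Fin n} :
    (cutAbove σ M).part i = (cutAbove σ M).part j ↔
      σ.part i = σ.part j ∧ ∀ m ∈ M, σ.part m = σ.part i → (m ≤ i ↔ m ≤ j) := by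
  unfold cutAbove
  rw [part_ofSetoid_eq_iff, Setoid.ker_def, Prod.mk.injEq]
  refine and_congr_right fun hσ => ?_
  simp only [Finset.ext_iff, mem_filter, hσ]
  refine forall_congr' fun m => ?_
  tauto

theorem cutAbove_lateralRefinement (σ : NodePartition n) (M : Finset (Fin n)) :
    LateralRefinement (cutAbove σ M) σ := by
  refine lateralRefinement_iff.2 ⟨le_iff_part_eq.2 fun i j h => (part_cutAbove_eq_iff.1 h).1, ?_⟩
  intro i j k hij hjk hσ hπ
  rw [part_cutAbove_eq_iff] at hπ ⊢
  exact ⟨hσ, fun m hm hmi => ⟨fun h => h.trans hij, fun h => (hπ.2 m hm hmi).2 (h.trans hjk)⟩⟩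

theorem le_cutAbove (h : ρ ≤ σ) {M : Finset (Fin n)} (hM : M ⊆ cutNodes ρ σ) :
    ρ ≤ cutAbove σ M := by
  rw [le_iff_part_eq] at h ⊢
  intro i j hij
  refine part_cutAbove_eq_iff.2 ⟨h i j hij, fun m hm hmi => ⟨?_, ?_⟩⟩
  · exact (mem_cutNodes.1 (hM hm)).2 i j hmi.symm hij
  · exact (mem_cutNodes.1 (hM hm)).2 j i ((h i j hij).symm.trans hmi.symm) hij.symm

theorem blockTops_cutAbove_sdiff {M : Finset (Fin n)} (hM : M ⊆ cutNodes ρ σ) :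
    blockTops (cutAbove σ M) \ blockTops σ = M := by
  ext m
  rw [mem_sdiff]
  constructor
  · rintro ⟨hm, hmσ⟩
    by_contra hmM
    have hex : ((σ.part m).filter (· < m)).Nonempty := by
      by_contra hne
      refine hmσ (mem_blockTops.2 fun j hj => not_lt.1 fun hjm => hne ⟨j, ?_⟩)
      exact mem_filter.2 ⟨(mem_part_iff_eq σ).2 hj, hjm⟩
    obtain ⟨hp, hpm⟩ := mem_filter.1 (max'_mem _ hex)
    set p := ((σ.part m).filter (· < m)).max' hex with hpdef
    rw [mem_part_iff_eq] at hp
    refine absurd (mem_blockTops.1 hm p (part_cutAbove_eq_iff.2 ⟨hp, fun m' hm' hmp => ?_⟩))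
      (not_le.2 hpm)
    refine ⟨fun h => h.trans hpm.le, fun h => le_max' _ _ (mem_filter.2 ⟨?_, ?_⟩)⟩
    · exact (mem_part_iff_eq σ).2 (hmp.trans hp)
    · exact lt_of_le_of_ne h fun e => hmM (e ▸ hm')
  · intro hm
    refine ⟨mem_blockTops.2 fun j hj => ?_, (mem_cutNodes.1 (hM hm)).1⟩
    rw [part_cutAbove_eq_iff] at hj
    exact (hj.2 m hm hj.1.symm).2 le_rfl

theorem LateralRefinement.le_of_blockTop (h : LateralRefinement π σ) {m i j : Fin n}
    (hm : m ∈ blockTops π) (hσ : σ.part i = σ.part m) (hij : π.part i = π.part j) (hmi : m ≤ i) :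
    m ≤ j := by
  obtain ⟨hle, hconv⟩ := lateralRefinement_iff.1 h
  by_contra hjm
  rw [not_le] at hjm
  have hσ' : σ.part j = σ.part m := (le_iff_part_eq.1 hle _ _ hij).symm.trans hσ
  exact absurd (mem_blockTops.1 hm j (hconv j m i hjm.le hmi hσ' hij.symm)) (not_le.2 hjm)

theorem blockTops_sdiff_subset_cutNodes (h : LateralRefinement π σ) (hρ : ρ ≤ π) :
    blockTops π \ blockTops σ ⊆ cutNodes ρ σ := by
  intro m hm
  obtain ⟨hm, hmσ⟩ := mem_sdiff.1 hm
  exact mem_cutNodes.2 ⟨hmσ, fun i j hi hij hmi =>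
    h.le_of_blockTop hm hi (le_iff_part_eq.1 hρ _ _ hij) hmi⟩

theorem cutAbove_blockTops_sdiff (h : LateralRefinement π σ) :
    cutAbove σ (blockTops π \ blockTops σ) = π := by
  obtain ⟨hle, hconv⟩ := lateralRefinement_iff.1 h
  rw [le_iff_part_eq] at hle
  refine eq_of_part_eq_iff fun i j => ?_
  rw [part_cutAbove_eq_iff]
  constructor
  · have key : ∀ i j, i ≤ j → σ.part i = σ.part j →
        (∀ m ∈ blockTops π \ blockTops σ, σ.part m = σ.part i → (m ≤ i ↔ m ≤ j)) →
        π.part i = π.part j := by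
      intro i j hij hσ hm
      obtain ⟨m, hmt, hmj, hmle⟩ := exists_blockTop π j
      have hσm : σ.part m = σ.part i := (hle _ _ hmj).trans hσ.symm
      have hmi : m ≤ i := by
        by_contra hlt
        have hm' : m ∉ blockTops σ := fun hmσ => hlt (mem_blockTops.1 hmσ i hσm.symm)
        exact hlt ((hm m (mem_sdiff.2 ⟨hmt, hm'⟩) hσm).2 hmle)
      exact (hconv m i j hmi hij hσm hmj).symm.trans hmj
    rintro ⟨hσ, hm⟩
    rcases le_total i j with hij | hij
    · exact key i j hij hσ hm
    · exact (key j i hij hσ.symm fun m hmM hmj => (hm m hmM (hmj.trans hσ.symm)).symm).symm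
  · intro hij
    refine ⟨hle _ _ hij, fun m hm hmi => ⟨?_, ?_⟩⟩
    · exact h.le_of_blockTop (mem_sdiff.1 hm).1 hmi.symm hij
    · exact h.le_of_blockTop (mem_sdiff.1 hm).1 ((hle _ _ hij).symm.trans hmi.symm) hij.symm

open Classical in
/-- The alternating sum over the lateral refinements of `σ` which are coarser than `ρ`. -/
theorem sum_lateralRefinement (h : ρ ≤ σ) :
    ∑ π : NodePartition n with ρ ≤ π ∧ LateralRefinement π σ,
      (-1 : ℂ) ^ ((#π.parts : ℤ) - (#σ.parts : ℤ)) = if cutNodes ρ σ = ∅ then 1 else 0 := by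
  have hpow : ∑ M ∈ (cutNodes ρ σ).powerset, (-1 : ℂ) ^ #M =
      if cutNodes ρ σ = ∅ then 1 else 0 := by
    have := congrArg (Int.cast : ℤ → ℂ) (sum_powerset_neg_one_pow_card (x := cutNodes ρ σ))
    push_cast at this
    exact this
  rw [← hpow]
  refine sum_bij' (fun π _ => blockTops π \ blockTops σ) (fun M _ => cutAbove σ M) ?_ ?_ ?_ ?_ ?_
  · intro π hπ
    have hπ := (mem_filter.1 hπ).2
    exact mem_powerset.2 (blockTops_sdiff_subset_cutNodes hπ.2 hπ.1)
  · intro M hM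
    exact mem_filter.2 ⟨mem_univ _, le_cutAbove h (mem_powerset.1 hM),
      cutAbove_lateralRefinement σ M⟩
  · intro π hπ
    exact cutAbove_blockTops_sdiff (mem_filter.1 hπ).2.2
  · intro M hM
    exact blockTops_cutAbove_sdiff (mem_powerset.1 hM)
  · intro π hπ
    have hsub := blockTops_subset (mem_filter.1 hπ).2.2.1
    have hcard := card_sdiff_add_card_eq_card hsub
    rw [card_blockTops, card_blockTops] at hcard
    rw [← hcard]
    push_cast
    rw [add_sub_cancel_right, zpow_natCast]

end Part

section Diagram

variable {n : ℕ} {χ : Fin n → Side} {ε : Fin n → Shade} {ρ σ : NodePartition n} {D : LRDiagram n}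

theorem LRDiagram.minimal_part_iff (hs : D.spines = []) (hσ : σ.parts = D.closed) :
    D.Minimal ρ.part ∅ ↔ ρ ≤ σ ∧ cutNodes ρ σ = ∅ := by
  constructor
  · intro h
    constructor
    · refine le_iff_part_eq.2 fun i j hij => ?_
      have hi := σ.part_mem.2 (mem_univ i)
      exact (σ.part_eq_of_mem hi
        (h.saturated_closed _ (hσ ▸ hi) i (σ.mem_part (mem_univ i)) j hij)).symm
    · refine eq_empty_of_forall_notMem fun m hm => ?_
      obtain ⟨hmσ, hcut⟩ := mem_cutNodes.1 hm
      rw [mem_blockTops] at hmσ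
      push Not at hmσ
      obtain ⟨j, hj, hjm⟩ := hmσ
      obtain ⟨v, hv, hmv, hfv | ⟨u, hu, huv⟩⟩ :=
        h.uncut_closed (σ.part m) (hσ ▸ σ.part_mem.2 (mem_univ m)) m
          ⟨j, (mem_part_iff_eq σ).2 hj, hjm⟩ ⟨m, σ.mem_part (mem_univ m), le_rfl⟩
      · exact hfv
      · exact absurd (hcut v u ((mem_part_iff_eq σ).1 hv) huv.symm hmv) (not_le.2 hu)
  · rintro ⟨hle, hcut⟩
    rw [le_iff_part_eq] at hle
    have hsat : ∀ X ∈ D.closed, Saturated ρ.part X := by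
      intro X hX i hi j hij
      rw [← hσ] at hX
      rw [← σ.part_eq_of_mem hX hi, mem_part_iff_eq]
      exact (hle _ _ hij).symm
    refine ⟨hsat, by simp [hs], ?_, by simp [hs], by simp, by simp [hs]⟩
    rintro X hX t ⟨i, hi, hit⟩ ⟨j, hj, htj⟩
    have hX' := hX
    rw [← hσ] at hX
    have hne : (X.filter fun j : Fin n => t ≤ (j : ℕ)).Nonempty := ⟨j, mem_filter.2 ⟨hj, htj⟩⟩
    obtain ⟨hmX, htm⟩ := mem_filter.1 (min'_mem _ hne)
    have hmin := fun x hx => min'_le (X.filter fun j : Fin n => t ≤ (j : ℕ)) x hx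
    set m := (X.filter fun j : Fin n => t ≤ (j : ℕ)).min' hne
    have hm : m ∉ cutNodes ρ σ := by rw [hcut]; exact notMem_empty m
    rw [mem_cutNodes] at hm
    push Not at hm
    obtain ⟨v, u, hv, huv, hmv, hum⟩ := hm (by
      intro htop
      have := mem_blockTops.1 htop i
        (by rw [σ.part_eq_of_mem hX hi, σ.part_eq_of_mem hX hmX])
      exact absurd (htm.trans this) (not_le.2 hit))
    have hvX : v ∈ X := by
      rw [← σ.part_eq_of_mem hX hmX, mem_part_iff_eq]; exact hv
    refine ⟨v, hvX, htm.trans hmv, Or.inr ⟨u, ?_, huv.symm⟩⟩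
    by_contra htu
    exact absurd (hmin u (mem_filter.2 ⟨hsat X hX' v hvX u huv, not_lt.1 htu⟩)) (not_le.2 hum)

theorem mem_shadedBNC_iff : σ ∈ shadedBNC χ ε ↔
    ∃ D ∈ LR χ ε, D.spines = [] ∧ σ.parts = D.closed := by
  simp only [shadedBNC, LRk, mem_filter, Set.mem_ofPred_eq, List.length_eq_zero_iff, and_assoc]

theorem isBiNonCrossing_of_mem_shadedBNC (h : σ ∈ shadedBNC χ ε) : IsBiNonCrossing χ σ := by
  obtain ⟨D, hD, -, hσ⟩ := mem_shadedBNC_iff.1 h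
  rw [isBiNonCrossing_iff, hσ]
  exact (planar_of_mem_LR hD).nonCrossing

theorem le_shadingPartition_of_mem_shadedBNC (h : σ ∈ shadedBNC χ ε) :
    σ ≤ shadingPartition ε := by
  obtain ⟨D, hD, -, hσ⟩ := mem_shadedBNC_iff.1 h
  refine le_shadingPartition_iff.2 fun i j hij => ?_
  refine (planar_of_mem_LR hD).shade_closed (σ.part j) (hσ ▸ σ.part_mem.2 (mem_univ j)) i ?_ j
    (σ.mem_part (mem_univ j))
  exact (mem_part_iff_eq σ).2 hij

theorem LRDiagram.Planar.exists_partition (hD : D.Planar χ ε) (hs : D.spines = []) :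
    ∃ σ : NodePartition n, σ.parts = D.closed := by
  refine ⟨Finpartition.ofExistsUnique D.closed (fun _ _ => subset_univ _) (fun i _ => ?_)
    (fun h => not_nonempty_empty (hD.nonempty_closed _ h)), rfl⟩
  rcases hD.cover i with ⟨X, hX, hi⟩ | ⟨S, hS, -⟩
  · exact ⟨X, ⟨hX, hi⟩, fun Y hY => hD.disjoint_closed Y hY.1 X hX i hY.2 hi⟩
  · simp [hs] at hS

theorem existsUnique_shadedBNC (hρ : IsBiNonCrossing χ ρ) (hε : ρ ≤ shadingPartition ε) :
    ∃! σ, σ ∈ shadedBNC χ ε ∧ ρ ≤ σ ∧ cutNodes ρ σ = ∅ := by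
  obtain ⟨D, ⟨hD, hm⟩, huniq⟩ := existsUnique_minimal χ ε ρ.part ∅
    ⟨fun a b c d hab hbc hcd hac hbd => hρ.part_eq hab hbc hcd hac hbd, by simp⟩
    (le_shadingPartition_iff.1 hε)
  have hs : D.spines = [] := List.eq_nil_iff_forall_not_mem.2 fun S hS => by
    obtain ⟨i, -, hi⟩ := hm.spine_mem S hS
    exact hi
  obtain ⟨σ, hσ⟩ := (planar_of_mem_LR hD).exists_partition hs
  refine ⟨σ, ⟨mem_shadedBNC_iff.2 ⟨D, hD, hs, hσ⟩, (LRDiagram.minimal_part_iff hs hσ).1 hm⟩, ?_⟩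
  rintro τ ⟨hτ, hτm⟩
  obtain ⟨E, hE, hEs, hτE⟩ := mem_shadedBNC_iff.1 hτ
  have := huniq E ⟨hE, (LRDiagram.minimal_part_iff hEs hτE).2 hτm⟩
  subst this
  exact Finpartition.ext (hτE.trans hσ.symm)

end Diagram

open Classical in
/-- The signed number of the `σ ∈ BNC(χ, ε)` of which `π` is a lateral refinement. -/
noncomputable def lateralSum {n : ℕ} (χ : Fin n → Side) (ε : Fin n → Shade)
    (π : NodePartition n) : ℂ :=
  ∑ σ : NodePartition n with σ ∈ shadedBNC χ ε ∧ LateralRefinement π σ,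
    (-1 : ℂ) ^ ((#π.parts : ℤ) - (#σ.parts : ℤ))

open Classical in
theorem sum_lateralSum {n : ℕ} {χ : Fin n → Side} {ε : Fin n → Shade} (ρ : BNC χ)
    (hε : ρ.1 ≤ shadingPartition ε) :
    ∑ π : BNC χ with ρ ≤ π ∧ π.1 ≤ shadingPartition ε, lateralSum χ ε π.1 = 1 := by
  unfold lateralSum
  have hcomm : ∀ (π : BNC χ) (σ : NodePartition n),
      (π ∈ univ.filter (fun π : BNC χ => ρ ≤ π ∧ π.1 ≤ shadingPartition ε) ∧
        σ ∈ univ.filter (fun σ => σ ∈ shadedBNC χ ε ∧ LateralRefinement π.1 σ)) ↔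
      (π ∈ univ.filter (fun π : BNC χ => ρ ≤ π ∧ LateralRefinement π.1 σ) ∧
        σ ∈ univ.filter (fun σ => σ ∈ shadedBNC χ ε)) := by
    intro π σ
    simp only [mem_filter, mem_univ, true_and]
    constructor
    · tauto
    · rintro ⟨⟨h1, h2⟩, h3⟩
      exact ⟨⟨h1, h2.1.trans (le_shadingPartition_of_mem_shadedBNC h3)⟩, h3, h2⟩
  rw [sum_comm' hcomm]
  have hinner : ∀ σ ∈ univ.filter (fun σ => σ ∈ shadedBNC χ ε),
      ∑ π : BNC χ with ρ ≤ π ∧ LateralRefinement π.1 σ,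
        (-1 : ℂ) ^ ((#π.1.parts : ℤ) - (#σ.parts : ℤ)) =
      if ρ.1 ≤ σ ∧ cutNodes ρ.1 σ = ∅ then 1 else 0 := by
    intro σ hσ
    have hσ := (mem_filter.1 hσ).2
    by_cases hle : ρ.1 ≤ σ
    · simp only [hle, true_and]
      rw [← sum_lateralRefinement hle]
      refine sum_bij (fun π _ => π.1) ?_ ?_ ?_ (fun _ _ => rfl)
      · intro π hπ
        exact mem_filter.2 ⟨mem_univ _, (mem_filter.1 hπ).2⟩
      · intro π _ π' _ h
        exact Subtype.ext h
      · intro π hπ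
        have hπ := (mem_filter.1 hπ).2
        exact ⟨⟨π, hπ.2.isBiNonCrossing (isBiNonCrossing_of_mem_shadedBNC hσ)⟩,
          mem_filter.2 ⟨mem_univ _, hπ⟩, rfl⟩
    · rw [if_neg fun h => hle h.1]
      refine sum_eq_zero fun π hπ => ?_
      have hπ := (mem_filter.1 hπ).2
      exact absurd (le_trans (show ρ.1 ≤ π.1 from hπ.1) hπ.2.1) hle
  rw [sum_congr rfl hinner]
  obtain ⟨σ₀, ⟨hσ₀, hle₀⟩, huniq⟩ := existsUnique_shadedBNC ρ.2 hε
  rw [sum_eq_single_of_mem σ₀ (mem_filter.2 ⟨mem_univ _, hσ₀⟩), if_pos hle₀]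
  intro σ hσ hne
  exact if_neg fun h => hne (huniq σ ⟨(mem_filter.1 hσ).2, h⟩)

open Classical in
theorem mainTheorem6 (n : ℕ) (χ : Fin n → Side) (ε : Fin n → Shade)
    (π : BNC χ) (hπ : π.1 ≤ shadingPartition ε) :
    (∑ σ : NodePartition n with σ ∈ shadedBNC χ ε ∧ LateralRefinement π.1 σ,
        (-1 : ℂ) ^ ((#π.1.parts : ℤ) - (#σ.parts : ℤ))) =
      ∑ σ : BNC χ with π ≤ σ ∧ σ.1 ≤ shadingPartition ε, muBNC π σ := by
  change lateralSum χ ε π.1 = _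
  have hcomm : ∀ σ τ : BNC χ,
      (σ ∈ univ.filter (fun σ : BNC χ => π ≤ σ ∧ σ.1 ≤ shadingPartition ε) ∧
        τ ∈ univ.filter (fun τ : BNC χ => σ ≤ τ ∧ τ.1 ≤ shadingPartition ε)) ↔
      (σ ∈ Icc π τ ∧
        τ ∈ univ.filter (fun τ : BNC χ => τ.1 ≤ shadingPartition ε)) := by
    intro σ τ
    simp only [mem_filter, mem_univ, true_and, mem_Icc]
    constructor
    · tauto
    · rintro ⟨⟨h1, h2⟩, h3⟩
      exact ⟨⟨h1, le_trans (show σ.1 ≤ τ.1 from h2) h3⟩, h2, h3⟩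
  symm
  calc ∑ σ : BNC χ with π ≤ σ ∧ σ.1 ≤ shadingPartition ε, muBNC π σ
      = ∑ σ : BNC χ with π ≤ σ ∧ σ.1 ≤ shadingPartition ε,
          ∑ τ : BNC χ with σ ≤ τ ∧ τ.1 ≤ shadingPartition ε,
            muBNC π σ * lateralSum χ ε τ.1 := by
        refine sum_congr rfl fun σ hσ => ?_
        rw [← mul_sum, sum_lateralSum σ (mem_filter.1 hσ).2.2, mul_one]
    _ = ∑ τ : BNC χ with τ.1 ≤ shadingPartition ε,
          ∑ σ ∈ Icc π τ, muBNC π σ * lateralSum χ ε τ.1 := sum_comm' hcomm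
    _ = ∑ τ : BNC χ with τ.1 ≤ shadingPartition ε,
          (if π = τ then 1 else 0) * lateralSum χ ε τ.1 := by
        refine sum_congr rfl fun τ _ => ?_
        rw [← sum_mul, ← IncidenceAlgebra.sum_Icc_mu_right]
        rfl
    _ = lateralSum χ ε π.1 := by
        simp only [ite_mul, one_mul, zero_mul]
        rw [sum_ite_eq]
        simp [hπ]
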